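/- Let $(\Omega,\Sigma,\mathbb P)$ be a nonatomic probability space. Let $\Phi:[0,\infty)\to[0,\infty)$ be an Orlicz function, i.e. convex, increasing, with $\Phi(0)=0$; assume $\lim_{t\to\infty}\Phi(t)/t=\infty$ and $\Phi(t)>0$ for all $t>0$. Let $\Psi(s)=\sup\{ts-\Phi(t):t\ge 0\}$, $s\ge 0$, be its conjugate, which is again an Orlicz function. For an Orlicz function $\Theta$, let $L^\Theta$ be the space of all real random variables $X$ (modulo a.s. equality) with $$\|X\|_\Theta=\inf\{\lambda>0:\mathbb E[\Theta(|X|/\lambda)]\le 1\}<\infty,$$ and say that $\Theta$ satisfies the $\Delta_2$-condition if there are $t_0\in(0,\infty)$ and $k\in\mathbb R$ with $\Theta(2t)<k\,\Theta(t)$ for all $t\ge t_0$. Let $\sigma(L^\Phi,L^\Psi)$ be the coarsest topology on $L^\Phi$ making $X\mapsto\mathbb E[XY]$ continuous for every $Y\in L^\Psi$. A sequence $(X_n)$ in $L^\Phi$ order converges to $X\in L^\Phi$ if $X_n\to X$ a.s. and there is $U\in L^\Phi$ with $|X_n|\le U$ a.s. for all $n$; a set $\mathcal C\subset L^\Phi$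 is order closed if it equals the set of all limits in $L^\Phi$ of order convergent sequences of elements of $\mathcal C$. If $\Phi$ and $\Psi$ both fail the $\Delta_2$-condition, then there is a set $\mathcal C\subset L^\Phi$ such that (i) $\mathcal C$ is monotone: if $X_2\in\mathcal C$, $X_1\in L^\Phi$ and $X_1\ge X_2$ a.s., then $X_1\in\mathcal C$; (ii) $\mathcal C$ is positively homogeneous: $\lambda\,\mathcal C\subset\mathcal C$ for every real $\lambda\ge 0$; (iii) $\mathcal C$ is additive: $\mathcal C+\mathcal C\subset\mathcal C$; (iv) $\mathcal C$ is order closed but not $\sigma(L^\Phi,L^\Psi)$-closed; (v) for every $X\in L^\Phi$ there is $k\in\mathbb R$ with $X-k\mathbf 1\notin\mathcal C$, where $\mathbf 1$ is the constant random variable $1$. -/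

import Mathlib

open MeasureTheory Filter Topology Set
open scoped ENNReal

namespace Orlicz

/-- An Orlicz function `Φ : [0, ∞) → [0, ∞)`: convex, increasing, `Φ 0 = 0`.  It is represented by
a function on `ℝ` of which only the values on `[0, ∞)` are ever used. -/
structure IsOrliczFunction (Φ : ℝ → ℝ) : Prop where
  convexOn : ConvexOn ℝ (Ici 0) Φ
  monotoneOn : MonotoneOn Φ (Ici 0)
  map_zero : Φ 0 = 0

/-- The conjugate function `Ψ(s) = sup {t s - Φ(t) : t ≥ 0}`. -/
noncomputable def conjugate (Φ : ℝ → ℝ) (s : ℝ) : ℝ :=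
  sSup ((fun t : ℝ => t * s - Φ t) '' Ici 0)

/-- `Φ(t) / t → ∞` as `t → ∞`. -/
def IsSuperlinear (Φ : ℝ → ℝ) : Prop :=
  Tendsto (fun t : ℝ => Φ t / t) atTop atTop

/-- The `Δ₂`-condition: `Φ(2t) < k Φ(t)` for all large `t`, for some real `k`. -/
def DeltaTwo (Φ : ℝ → ℝ) : Prop :=
  ∃ t₀ : ℝ, 0 < t₀ ∧ ∃ k : ℝ, ∀ t : ℝ, t₀ ≤ t → Φ (2 * t) < k * Φ t

theorem IsOrliczFunction.nonneg {Φ : ℝ → ℝ} (hΦ : IsOrliczFunction Φ) {t : ℝ} (ht : 0 ≤ t) :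
    0 ≤ Φ t := by
  have h := hΦ.monotoneOn (mem_Ici.2 le_rfl) (mem_Ici.2 ht) ht
  rwa [hΦ.map_zero] at h

/-- Under superlinear growth the supremum defining the conjugate is finite. -/
theorem IsOrliczFunction.bddAbove_conjugate {Φ : ℝ → ℝ} (hΦ : IsOrliczFunction Φ)
    (hlim : IsSuperlinear Φ) (s : ℝ) :
    BddAbove ((fun t : ℝ => t * s - Φ t) '' Ici 0) := by
  obtain ⟨T, hT⟩ := eventually_atTop.1 (hlim.eventually_ge_atTop s)
  refine ⟨(max T 1) * |s|, ?_⟩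
  rintro _ ⟨t, ht, rfl⟩
  have ht0 : (0 : ℝ) ≤ t := ht
  have hM : (0 : ℝ) ≤ max T 1 := le_trans zero_le_one (le_max_right _ _)
  show t * s - Φ t ≤ max T 1 * |s|
  rcases le_total t (max T 1) with h | h
  · have h1 : t * s ≤ t * |s| := mul_le_mul_of_nonneg_left (le_abs_self s) ht0
    have h2 : t * |s| ≤ max T 1 * |s| := mul_le_mul_of_nonneg_right h (abs_nonneg s)
    linarith [hΦ.nonneg ht0]
  · have ht1 : 0 < t := lt_of_lt_of_le zero_lt_one ((le_max_right T 1).trans h)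
    have h1 := hT t ((le_max_left T 1).trans h)
    rw [le_div_iff₀ ht1] at h1
    have h2 : 0 ≤ max T 1 * |s| := mul_nonneg hM (abs_nonneg s)
    linarith

/-- Young's inequality. -/
theorem IsOrliczFunction.young {Φ : ℝ → ℝ} (hΦ : IsOrliczFunction Φ) (hlim : IsSuperlinear Φ)
    {t : ℝ} (ht : 0 ≤ t) (s : ℝ) : t * s - Φ t ≤ conjugate Φ s :=
  le_csSup (hΦ.bddAbove_conjugate hlim s) ⟨t, ht, rfl⟩

theorem conjugate_le {Φ : ℝ → ℝ} {s c : ℝ} (h : ∀ t : ℝ, 0 ≤ t → t * s - Φ t ≤ c) :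
    conjugate Φ s ≤ c := by
  refine csSup_le ⟨_, 0, mem_Ici.2 le_rfl, rfl⟩ ?_
  rintro _ ⟨t, ht, rfl⟩
  exact h t ht

/-- The conjugate of an Orlicz function of superlinear growth is an Orlicz function. -/
theorem IsOrliczFunction.conjugate {Φ : ℝ → ℝ} (hΦ : IsOrliczFunction Φ)
    (hlim : IsSuperlinear Φ) : IsOrliczFunction (conjugate Φ) where
  convexOn := by
    refine ⟨convex_Ici 0, fun x _ y _ a b ha hb hab => conjugate_le fun t ht => ?_⟩
    have h1 := mul_le_mul_of_nonneg_left (hΦ.young hlim ht x) ha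
    have h2 := mul_le_mul_of_nonneg_left (hΦ.young hlim ht y) hb
    have h3 : t * (a • x + b • y) - Φ t = a * (t * x - Φ t) + b * (t * y - Φ t) := by
      obtain rfl : b = 1 - a := by linarith
      simp only [smul_eq_mul]; ring
    rw [h3]
    simpa only [smul_eq_mul] using add_le_add h1 h2
  monotoneOn := fun x _ y _ hxy => conjugate_le fun t ht => by
    have h1 := hΦ.young hlim ht y
    have h2 := mul_le_mul_of_nonneg_left hxy ht
    linarith
  map_zero := by
    refine le_antisymm (conjugate_le fun t ht => ?_) ?_
    · have := hΦ.nonneg ht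
      linarith
    · have h := hΦ.young hlim (le_refl (0 : ℝ)) 0
      rw [hΦ.map_zero] at h
      linarith

/-- The measure `μ` is nonatomic: every measurable set of positive measure has a measurable subset
of strictly smaller positive measure. -/
def IsNonatomic {Ω : Type*} [MeasurableSpace Ω] (μ : Measure Ω) : Prop :=
  ∀ A : Set Ω, MeasurableSet A → 0 < μ A →
    ∃ B : Set Ω, MeasurableSet B ∧ B ⊆ A ∧ 0 < μ B ∧ μ B < μ A

section Space

variable {Ω : Type*} [MeasurableSpace Ω] {μ : Measure Ω}

/-- The expectation `𝔼[Φ(|X| / l)]`, with values in `[0, ∞]`. -/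
noncomputable def modular (Φ : ℝ → ℝ) (X : Ω →ₘ[μ] ℝ) (l : ℝ) : ℝ≥0∞ :=
  ∫⁻ ω, ENNReal.ofReal (Φ (|X ω| / l)) ∂μ

/-- The Luxemburg norm `inf {l > 0 : 𝔼[Φ(|X| / l)] ≤ 1}`, with `inf ∅ = ∞`. -/
noncomputable def luxemburgNorm (Φ : ℝ → ℝ) (X : Ω →ₘ[μ] ℝ) : ℝ≥0∞ :=
  sInf (ENNReal.ofReal '' {l : ℝ | 0 < l ∧ modular Φ X l ≤ 1})

theorem luxemburgNorm_lt_top_iff {Φ : ℝ → ℝ} {X : Ω →ₘ[μ] ℝ} :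
    luxemburgNorm Φ X < ∞ ↔ ∃ l : ℝ, 0 < l ∧ modular Φ X l ≤ 1 := by
  unfold luxemburgNorm
  rw [sInf_lt_iff]
  constructor
  · rintro ⟨_, ⟨l, hl, rfl⟩, -⟩
    exact ⟨l, hl⟩
  · rintro ⟨l, hl⟩
    exact ⟨_, ⟨l, hl, rfl⟩, ENNReal.ofReal_lt_top⟩

theorem IsOrliczFunction.aemeasurable {Φ : ℝ → ℝ} (hΦ : IsOrliczFunction Φ) (X : Ω →ₘ[μ] ℝ)
    {l : ℝ} (hl : 0 < l) : AEMeasurable (fun ω => Φ (|X ω| / l)) μ := by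
  have hm : Monotone fun x : ℝ => Φ (max x 0) := fun x y hxy =>
    hΦ.monotoneOn (mem_Ici.2 (le_max_right _ _)) (mem_Ici.2 (le_max_right _ _))
      (max_le_max_right 0 hxy)
  have h1 : AEMeasurable (fun ω => |X ω| / l) μ :=
    (X.aestronglyMeasurable.aemeasurable.norm).div_const l
  have h2 := hm.measurable.comp_aemeasurable h1
  refine h2.congr (Eventually.of_forall fun ω => ?_)
  have : 0 ≤ |X ω| / l := div_nonneg (abs_nonneg _) hl.le
  simp [max_eq_left this]

/-- The Orlicz space `L^Φ`: all real random variables, modulo a.s. equality, of finite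
Luxemburg norm. -/
noncomputable def orliczSpace (Φ : ℝ → ℝ) (hΦ : IsOrliczFunction Φ) (μ : Measure Ω) :
    Submodule ℝ (Ω →ₘ[μ] ℝ) where
  carrier := {X | luxemburgNorm Φ X < ∞}
  zero_mem' := by
    refine luxemburgNorm_lt_top_iff.2 ⟨1, one_pos, ?_⟩
    have h : modular Φ (0 : Ω →ₘ[μ] ℝ) 1 = 0 := by
      refine (lintegral_congr_ae ?_).trans lintegral_zero
      filter_upwards [AEEqFun.coeFn_zero (α := Ω) (β := ℝ) (μ := μ)] with ω hω
      simp [hω, hΦ.map_zero]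
    rw [h]
    exact zero_le_one
  add_mem' := by
    intro X Y hX hY
    obtain ⟨l, hl, hXl⟩ := luxemburgNorm_lt_top_iff.1 hX
    obtain ⟨m, hm, hYm⟩ := luxemburgNorm_lt_top_iff.1 hY
    refine luxemburgNorm_lt_top_iff.2 ⟨l + m, add_pos hl hm, ?_⟩
    have hlm : 0 < l + m := add_pos hl hm
    have ha : 0 ≤ l / (l + m) := by positivity
    have hb : 0 ≤ m / (l + m) := by positivity
    have hab : l / (l + m) + m / (l + m) = 1 := by field_simp
    calc modular Φ (X + Y) (l + m)
        ≤ ∫⁻ ω, (ENNReal.ofReal (l / (l + m)) * ENNReal.ofReal (Φ (|X ω| / l)) +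
            ENNReal.ofReal (m / (l + m)) * ENNReal.ofReal (Φ (|Y ω| / m))) ∂μ := by
          refine lintegral_mono_ae ?_
          filter_upwards [AEEqFun.coeFn_add X Y] with ω hω
          have hx : 0 ≤ |X ω| / l := by positivity
          have hy : 0 ≤ |Y ω| / m := by positivity
          have h1 : |(X + Y) ω| / (l + m) ≤
              (l / (l + m)) * (|X ω| / l) + (m / (l + m)) * (|Y ω| / m) := by
            have e : (l / (l + m)) * (|X ω| / l) + (m / (l + m)) * (|Y ω| / m) =
                (|X ω| + |Y ω|) / (l + m) := by field_simp
            rw [e, hω, Pi.add_apply]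
            gcongr
            exact abs_add_le _ _
          have h0 : 0 ≤ |(X + Y) ω| / (l + m) := by positivity
          have h2 := hΦ.monotoneOn (mem_Ici.2 h0) (mem_Ici.2 (h0.trans h1)) h1
          have h3 := hΦ.convexOn.2 (mem_Ici.2 hx) (mem_Ici.2 hy) ha hb hab
          simp only [smul_eq_mul] at h3
          rw [← ENNReal.ofReal_mul ha, ← ENNReal.ofReal_mul hb,
            ← ENNReal.ofReal_add (mul_nonneg ha (hΦ.nonneg hx)) (mul_nonneg hb (hΦ.nonneg hy))]
          exact ENNReal.ofReal_le_ofReal (h2.trans h3)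
      _ = ENNReal.ofReal (l / (l + m)) * modular Φ X l +
            ENNReal.ofReal (m / (l + m)) * modular Φ Y m := by
          rw [lintegral_add_left' ((hΦ.aemeasurable X hl).ennreal_ofReal.const_mul _),
            lintegral_const_mul' _ _ ENNReal.ofReal_ne_top,
            lintegral_const_mul' _ _ ENNReal.ofReal_ne_top]
          rfl
      _ ≤ ENNReal.ofReal (l / (l + m)) * 1 + ENNReal.ofReal (m / (l + m)) * 1 := by gcongr
      _ = 1 := by
          rw [mul_one, mul_one, ← ENNReal.ofReal_add ha hb, hab, ENNReal.ofReal_one]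
  smul_mem' := by
    intro c X hX
    obtain ⟨l, hl, hXl⟩ := luxemburgNorm_lt_top_iff.1 hX
    have hc : 0 < |c| + 1 := by positivity
    refine luxemburgNorm_lt_top_iff.2 ⟨(|c| + 1) * l, mul_pos hc hl, le_trans ?_ hXl⟩
    refine lintegral_mono_ae ?_
    filter_upwards [AEEqFun.coeFn_smul c X] with ω hω
    refine ENNReal.ofReal_le_ofReal (hΦ.monotoneOn ?_ ?_ ?_)
    · exact mem_Ici.2 (by positivity)
    · exact mem_Ici.2 (by positivity)
    · rw [hω, Pi.smul_apply, smul_eq_mul, abs_mul, div_le_div_iff₀ (by positivity) hl]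
      nlinarith [mul_nonneg (abs_nonneg (X ω)) hl.le]

theorem one_mem_orliczSpace {Φ : ℝ → ℝ} (hΦ : IsOrliczFunction Φ) (μ : Measure Ω)
    [IsProbabilityMeasure μ] : (1 : Ω →ₘ[μ] ℝ) ∈ orliczSpace Φ hΦ μ := by
  set l : ℝ := max 1 (Φ 1) with hl
  have h1 : 1 ≤ l := le_max_left _ _
  have hl0 : 0 < l := zero_lt_one.trans_le h1
  refine luxemburgNorm_lt_top_iff.2 ⟨l, hl0, ?_⟩
  have key : Φ (1 / l) ≤ 1 := by
    have h := hΦ.convexOn.2 (mem_Ici.2 zero_le_one) (mem_Ici.2 le_rfl)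
      (show (0 : ℝ) ≤ 1 / l by positivity)
      (show (0 : ℝ) ≤ 1 - 1 / l by rw [sub_nonneg, div_le_one hl0]; exact h1)
      (by ring)
    simp only [smul_eq_mul, mul_one, mul_zero, add_zero, hΦ.map_zero] at h
    refine h.trans ?_
    rw [one_div, inv_mul_le_iff₀ hl0, mul_one]
    exact le_max_right _ _
  calc modular Φ (1 : Ω →ₘ[μ] ℝ) l ≤ ∫⁻ _, 1 ∂μ := by
        refine lintegral_mono_ae ?_
        filter_upwards [AEEqFun.coeFn_one (α := Ω) (β := ℝ) (μ := μ)] with ω hω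
        rw [hω, Pi.one_apply, abs_one, ← ENNReal.ofReal_one]
        exact ENNReal.ofReal_le_ofReal key
    _ = 1 := by simp

/-- The constant random variable `𝟏`, as an element of `L^Φ`. -/
noncomputable def one (Φ : ℝ → ℝ) (hΦ : IsOrliczFunction Φ) (μ : Measure Ω)
    [IsProbabilityMeasure μ] : orliczSpace Φ hΦ μ :=
  ⟨1, one_mem_orliczSpace hΦ μ⟩

/-- The pairing `𝔼[X Y]` of `X ∈ L^Φ` with `Y ∈ L^Ψ` is the integral of an integrable function. -/
theorem integrable_mul {Φ : ℝ → ℝ} (hΦ : IsOrliczFunction Φ) (hlim : IsSuperlinear Φ)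
    (X : orliczSpace Φ hΦ μ) (Y : orliczSpace (conjugate Φ) (hΦ.conjugate hlim) μ) :
    Integrable (fun ω => (X : Ω →ₘ[μ] ℝ) ω * (Y : Ω →ₘ[μ] ℝ) ω) μ := by
  obtain ⟨X, hX⟩ := X
  obtain ⟨Y, hY⟩ := Y
  obtain ⟨l, hl, hXl⟩ := luxemburgNorm_lt_top_iff.1 hX
  obtain ⟨m, hm, hYm⟩ := luxemburgNorm_lt_top_iff.1 hY
  have aux : ∀ {Θ : ℝ → ℝ} (hΘ : IsOrliczFunction Θ) (Z : Ω →ₘ[μ] ℝ) {a : ℝ}, 0 < a →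
      modular Θ Z a ≤ 1 → Integrable (fun ω => Θ (|Z ω| / a)) μ := by
    intro Θ hΘ Z a ha hZ
    refine ⟨(hΘ.aemeasurable Z ha).aestronglyMeasurable, ?_⟩
    rw [hasFiniteIntegral_iff_ofReal (Eventually.of_forall fun ω => hΘ.nonneg (by positivity))]
    exact hZ.trans_lt ENNReal.one_lt_top
  refine (((aux hΦ X hl hXl).add (aux (hΦ.conjugate hlim) Y hm hYm)).const_mul (l * m)).mono'
    (X.aestronglyMeasurable.mul Y.aestronglyMeasurable) (Eventually.of_forall fun ω => ?_)
  have h := hΦ.young hlim (show 0 ≤ |X ω| / l by positivity) (|Y ω| / m)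
  have e : ‖X ω * Y ω‖ = l * m * ((|X ω| / l) * (|Y ω| / m)) := by
    rw [Real.norm_eq_abs, abs_mul]; field_simp
  show ‖X ω * Y ω‖ ≤ l * m * (Φ (|X ω| / l) + conjugate Φ (|Y ω| / m))
  rw [e]
  exact mul_le_mul_of_nonneg_left (by linarith) (by positivity)

/-- The weak topology `σ(E, F)` on `E` of the pairing `(X, Y) ↦ 𝔼[X Y]`: the coarsest topology
for which `X ↦ 𝔼[X Y]` is continuous for every `Y ∈ F`. -/
@[reducible]
noncomputable def weakTopology (E F : Submodule ℝ (Ω →ₘ[μ] ℝ)) : TopologicalSpace E :=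
  ⨅ Y : F, TopologicalSpace.induced
    (fun X : E => ∫ ω, (X : Ω →ₘ[μ] ℝ) ω * (Y : Ω →ₘ[μ] ℝ) ω ∂μ) inferInstance

/-- The sequence `(X n)` is order bounded in `E`: it is dominated by some element of `E`. -/
def OrderBounded {E : Submodule ℝ (Ω →ₘ[μ] ℝ)} (X : ℕ → E) : Prop :=
  ∃ U : E, ∀ n, ∀ᵐ ω ∂μ, |(X n : Ω →ₘ[μ] ℝ) ω| ≤ (U : Ω →ₘ[μ] ℝ) ω

/-- The sequence `(X n)` order converges in `E` to `X'`: it is order bounded in `E` and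
converges a.s. to `X'`. -/
def OrderConverges {E : Submodule ℝ (Ω →ₘ[μ] ℝ)} (X : ℕ → E) (X' : E) : Prop :=
  (∀ᵐ ω ∂μ, Tendsto (fun n => (X n : Ω →ₘ[μ] ℝ) ω) atTop (𝓝 ((X' : Ω →ₘ[μ] ℝ) ω))) ∧
    OrderBounded X

/-- The order closure: all limits of order convergent sequences of elements of `C`. -/
def orderClosure {E : Submodule ℝ (Ω →ₘ[μ] ℝ)} (C : Set E) : Set E :=
  {X' | ∃ X : ℕ → E, (∀ n, X n ∈ C) ∧ OrderConverges X X'}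

/-- `C` is order closed if it equals its order closure. -/
def IsOrderClosed {E : Submodule ℝ (Ω →ₘ[μ] ℝ)} (C : Set E) : Prop :=
  C = orderClosure C

/-- `C` is monotone: `X₁ ≥ X₂` a.s. and `X₂ ∈ C` imply `X₁ ∈ C`. -/
def IsMonotone {E : Submodule ℝ (Ω →ₘ[μ] ℝ)} (C : Set E) : Prop :=
  ∀ X₁ X₂ : E, (∀ᵐ ω ∂μ, (X₂ : Ω →ₘ[μ] ℝ) ω ≤ (X₁ : Ω →ₘ[μ] ℝ) ω) → X₂ ∈ C → X₁ ∈ C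

/-- `C` is positively homogeneous: `l C ⊆ C` for every real `l ≥ 0`. -/
def IsPositivelyHomogeneous {E : Submodule ℝ (Ω →ₘ[μ] ℝ)} (C : Set E) : Prop :=
  ∀ l : ℝ, 0 ≤ l → ∀ X ∈ C, l • X ∈ C

/-- `C` is additive: `C + C ⊆ C`. -/
def IsAdditive {E : Submodule ℝ (Ω →ₘ[μ] ℝ)} (C : Set E) : Prop :=
  ∀ X₁ ∈ C, ∀ X₂ ∈ C, X₁ + X₂ ∈ C

end Space

end Orlicz

namespace Orlicz

/-! ### Nonatomic measures: sets and partitions of prescribed measure. -/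

section Nonatomic

variable {Ω : Type*} [MeasurableSpace Ω] {μ : Measure Ω}

/-! Split `Ω` into countably many cells `rest`, `base`, `tail j`, `grid p` with `p = (m, n)`. Let
`G_n` be `t j` on the cells `tail j` with `j ≥ n`, let `E_p` be `s p` on `grid p`, and put `X_p =
-1_base + (m+1) G_n + (m+1)⁻¹ E_p`. The cone consists of all `X` above some `∑ a_p X_p` with `a ≥ 0`
and `∑ (m+1) a_p < ∞`.

It is not weakly closed. Each pairing sends `G_n` to `0` (`tendsto_pairing_tailVal`) and is bounded
on the `E_p` (`exists_abs_pairing_le`), so `X_p → -1_base` when first `n → ∞`, then `m → ∞`. But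
`-1_base` is outside the cone: the cells `grid p` force `a = 0`, and then `base` gives `0 ≤ -1`.

It is order closed because an order bound `U ∈ L^Φ` prevents coefficient mass from escaping in
either direction. Since `Φ` fails `Δ₂`, `G_0` can lie in `L^Φ` while `2 G_0` has modular above `1`
on every single tail cell; hence `U` bounds `∑ (m+1) a_p` (`exists_tsum_le`) and little mass sits at
large `m`. Since `Ψ` fails `Δ₂`, one `H ∈ L^Ψ` satisfies `𝔼[E_p H] = 1/2` for all `p` although the
`E_p` are norm bounded; integrating `|U H|` over the grid cells gives `a_p ≤ (m+1) u_p` with `u`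
summable (`exists_summable_bound`), so for bounded `m` no mass escapes as `n → ∞`. Along a
coordinatewise convergent subsequence `∑ a_p` therefore loses nothing (`le_tsum_of_tendsto`), which
is what the negative value on `base` requires; the other cells need only Fatou.

On `rest` every combination vanishes, so no `X` stays in the cone after subtracting arbitrarily
large constants. -/

theorem IsNonatomic.exists_subset_le_half [IsFiniteMeasure μ] (hμ : IsNonatomic μ) {A : Set Ω}
    (hA : MeasurableSet A) (h0 : 0 < μ A) :
    ∃ B, MeasurableSet B ∧ B ⊆ A ∧ 0 < μ B ∧ μ B ≤ μ A / 2 := by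
  obtain ⟨B, hB, hBA, hB0, hlt⟩ := hμ A hA h0
  have hsum : μ B + μ (A \ B) = μ A := by
    rw [measure_add_sdiff hB.nullMeasurableSet, union_eq_self_of_subset_left hBA]
  rcases le_total (μ B) (μ A / 2) with h | h
  · exact ⟨B, hB, hBA, hB0, h⟩
  · refine ⟨A \ B, hA.diff hB, sdiff_subset, ?_, ?_⟩
    · rw [pos_iff_ne_zero]
      intro h1
      rw [h1, add_zero] at hsum
      exact hlt.ne hsum
    · by_contra! h2
      have := ENNReal.add_lt_add_of_le_of_lt (ENNReal.div_ne_top (measure_ne_top μ A) two_ne_zero) h h2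
      rw [hsum, ENNReal.add_halves] at this
      exact this.false

/-- Iterated halving. -/
theorem IsNonatomic.exists_subset_le [IsFiniteMeasure μ] (hμ : IsNonatomic μ) {A : Set Ω}
    (hA : MeasurableSet A) (h0 : 0 < μ A) {ε : ℝ≥0∞} (hε : ε ≠ 0) :
    ∃ B, MeasurableSet B ∧ B ⊆ A ∧ 0 < μ B ∧ μ B ≤ ε := by
  have key : ∀ n : ℕ, ∃ B, MeasurableSet B ∧ B ⊆ A ∧ 0 < μ B ∧ μ B ≤ μ A * 2⁻¹ ^ n := by
    intro n
    induction n with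
    | zero => exact ⟨A, hA, Subset.rfl, h0, by simp⟩
    | succ n ih =>
      obtain ⟨B, hB, hBA, hB0, hle⟩ := ih
      obtain ⟨B', hB', hBA', hB0', hle'⟩ := hμ.exists_subset_le_half hB hB0
      refine ⟨B', hB', hBA'.trans hBA, hB0', hle'.trans ?_⟩
      rw [pow_succ, ← mul_assoc, div_eq_mul_inv]
      gcongr
  have hlim : Tendsto (fun n : ℕ => μ A * 2⁻¹ ^ n) atTop (𝓝 (μ A * 0)) :=
    ENNReal.Tendsto.const_mul (ENNReal.tendsto_pow_atTop_nhds_zero_of_lt_one (by simp))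
      (Or.inr (measure_ne_top μ A))
  rw [mul_zero] at hlim
  obtain ⟨n, hn⟩ := (hlim.eventually_lt_const (pos_iff_ne_zero.2 hε)).exists
  obtain ⟨B, hB, hBA, hB0, hle⟩ := key n
  exact ⟨B, hB, hBA, hB0, hle.trans hn.le⟩

/-- **Sierpiński's theorem**: a nonatomic finite measure takes all intermediate values. -/
theorem IsNonatomic.exists_superset_measure_eq [IsFiniteMeasure μ] (hμ : IsNonatomic μ)
    {S : Set Ω} (hS : MeasurableSet S) {d : ℝ≥0∞} (hSd : μ S ≤ d) (hd : d ≤ μ univ) :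
    ∃ T, MeasurableSet T ∧ S ⊆ T ∧ μ T = d := by
  have hdtop : d ≠ ∞ := (hd.trans_lt (measure_lt_top μ univ)).ne
  -- Greedy exhaustion: among the supersets of `A` of measure at most `d`, one comes within `1 / (n
  -- + 1)` of the supremum.
  have step : ∀ (n : ℕ) (A : {A : Set Ω // MeasurableSet A ∧ μ A ≤ d}),
      ∃ T : {A : Set Ω // MeasurableSet A ∧ μ A ≤ d}, A.1 ⊆ T.1 ∧
        ∀ T' : {A : Set Ω // MeasurableSet A ∧ μ A ≤ d}, A.1 ⊆ T'.1 →
          μ T'.1 ≤ μ T.1 + ((n : ℝ≥0∞) + 1)⁻¹ := by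
    intro n A
    by_contra! hcon
    set s : ℝ≥0∞ := ⨆ T : {T : {A : Set Ω // MeasurableSet A ∧ μ A ≤ d} // A.1 ⊆ T.1}, μ T.1.1
      with hs
    have hsd : s ≤ d := iSup_le fun T => T.1.2.2
    have hspos : s ≠ 0 := by
      obtain ⟨T', hT', hlt⟩ := hcon A Subset.rfl
      have := le_iSup (fun T : {T : {A : Set Ω // MeasurableSet A ∧ μ A ≤ d} // A.1 ⊆ T.1} =>
        μ T.1.1) ⟨T', hT'⟩
      exact (pos_of_gt (hlt.trans_le this)).ne'
    have hlt : s - ((n : ℝ≥0∞) + 1)⁻¹ < s :=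
      ENNReal.sub_lt_self (hsd.trans_lt hdtop.lt_top).ne hspos
        (ENNReal.inv_ne_zero.2 (by finiteness))
    obtain ⟨⟨T, hT⟩, hlt'⟩ := lt_iSup_iff.1 (hs ▸ hlt)
    obtain ⟨T', hT', hlt''⟩ := hcon T hT
    have h1 := le_iSup (fun T : {T : {A : Set Ω // MeasurableSet A ∧ μ A ≤ d} // A.1 ⊆ T.1} =>
        μ T.1.1) ⟨T', hT'⟩
    have h2 : s ≤ μ T.1 + ((n : ℝ≥0∞) + 1)⁻¹ := tsub_le_iff_right.1 hlt'.le
    exact (h2.trans_lt hlt'').not_ge h1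
  choose next hsub hnext using step
  let seq : ℕ → {A : Set Ω // MeasurableSet A ∧ μ A ≤ d} := fun n =>
    Nat.rec ⟨S, hS, hSd⟩ (fun n A => next n A) n
  have hmono : Monotone fun n => (seq n).1 := monotone_nat_of_le_succ fun n => hsub n (seq n)
  set T : Set Ω := ⋃ n, (seq n).1 with hT
  have hTm : MeasurableSet T := MeasurableSet.iUnion fun n => (seq n).2.1
  have hTd : μ T ≤ d := by
    rw [hT, hmono.measure_iUnion]
    exact iSup_le fun n => (seq n).2.2
  refine ⟨T, hTm, subset_iUnion (fun n => (seq n).1) 0, hTd.antisymm ?_⟩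
  by_contra! hlt
  have hpos : 0 < μ Tᶜ := by
    rw [pos_iff_ne_zero]
    intro h0
    have := measure_add_measure_compl (μ := μ) hTm
    rw [h0, add_zero] at this
    exact (hlt.trans_le hd).ne this
  -- `B` fits into the gap `d - μ T`, so `T ∪ B` competes at every greedy stage, which forces `μ B ≤
  -- 1 / (n + 1)` for all `n`.
  obtain ⟨B, hB, hBT, hB0, hBle⟩ := hμ.exists_subset_le hTm.compl hpos (tsub_pos_of_lt hlt).ne'
  have hadd : μ (T ∪ B) = μ T + μ B :=
    measure_union (disjoint_left.2 fun x hx hx' => hBT hx' hx) hB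
  have hle : μ (T ∪ B) ≤ d := by
    rw [hadd]
    calc μ T + μ B ≤ μ T + (d - μ T) := by gcongr
      _ = d := add_tsub_cancel_of_le hTd
  have hBn : ∀ n : ℕ, μ B ≤ ((n : ℝ≥0∞) + 1)⁻¹ := by
    intro n
    have h1 := hnext n (seq n) ⟨T ∪ B, hTm.union hB, hle⟩
      ((subset_iUnion (fun n => (seq n).1) n).trans subset_union_left)
    have h2 : μ (next n (seq n)).1 ≤ μ T :=
      measure_mono (subset_iUnion (fun n => (seq n).1) (n + 1))
    have h3 : μ T + μ B ≤ μ T + ((n : ℝ≥0∞) + 1)⁻¹ := by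
      rw [← hadd]
      exact h1.trans (by gcongr)
    exact (ENNReal.add_le_add_iff_left (measure_ne_top μ T)).1 h3
  obtain ⟨n, hn⟩ := ENNReal.exists_inv_nat_lt hB0.ne'
  exact ((hBn n).trans (ENNReal.inv_le_inv.2 le_self_add)).not_gt hn

/-- Successive differences of an increasing chain whose measures are the partial sums of `c`. -/
theorem IsNonatomic.exists_seq_disjoint [IsFiniteMeasure μ] (hμ : IsNonatomic μ) {c : ℕ → ℝ≥0∞}
    (hc : ∑' n, c n ≤ μ univ) :
    ∃ S : ℕ → Set Ω, (∀ n, MeasurableSet (S n)) ∧ Pairwise (Function.onFun Disjoint S) ∧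
      ∀ n, μ (S n) = c n := by
  have hsum : ∀ n, ∑ i ∈ Finset.range n, c i ≤ μ univ := fun n =>
    (ENNReal.sum_le_tsum _).trans hc
  have step : ∀ (n : ℕ) (A : {A : Set Ω // MeasurableSet A ∧ μ A = ∑ i ∈ Finset.range n, c i}),
      ∃ T : {A : Set Ω // MeasurableSet A ∧ μ A = ∑ i ∈ Finset.range (n + 1), c i},
        A.1 ⊆ T.1 := by
    rintro n ⟨A, hA, hAμ⟩
    obtain ⟨T, hT, hAT, hTμ⟩ := hμ.exists_superset_measure_eq hA
      (d := ∑ i ∈ Finset.range (n + 1), c i)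
      (by rw [hAμ, Finset.sum_range_succ]; exact le_self_add) (hsum _)
    exact ⟨⟨T, hT, hTμ⟩, hAT⟩
  choose next hnext using step
  let T : (n : ℕ) → {A : Set Ω // MeasurableSet A ∧ μ A = ∑ i ∈ Finset.range n, c i} := fun n =>
    Nat.rec ⟨∅, MeasurableSet.empty, by simp⟩ next n
  have hsucc : ∀ n, (T n).1 ⊆ (T (n + 1)).1 := fun n => hnext n (T n)
  have hmono : Monotone fun n => (T n).1 := monotone_nat_of_le_succ hsucc
  refine ⟨fun n => (T (n + 1)).1 \ (T n).1, fun n => (T (n + 1)).2.1.diff (T n).2.1, ?_, ?_⟩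
  · rw [pairwise_disjoint_on]
    intro m n hmn
    exact disjoint_left.2 fun x hx hx' => hx'.2 (hmono hmn hx.1)
  · intro n
    rw [measure_sdiff (hsucc n) (T n).2.1.nullMeasurableSet (measure_ne_top μ _), (T (n + 1)).2.2,
      (T n).2.2, Finset.sum_range_succ]
    refine ENNReal.add_sub_cancel_left ?_
    rw [← (T n).2.2]
    exact measure_ne_top μ _

/-- A nonatomic probability space can be divided into countably many measurable cells of prescribed
measures, one distinguished cell `i₀` taking up the rest. -/
theorem IsNonatomic.exists_partition [IsProbabilityMeasure μ] (hμ : IsNonatomic μ) {ι : Type*}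
    [Countable ι] (i₀ : ι) {c : ι → ℝ≥0∞} (hc : ∑' i, c i ≤ 1) :
    ∃ idx : Ω → ι, (∀ s, MeasurableSet (idx ⁻¹' s)) ∧ (∀ i, i ≠ i₀ → μ (idx ⁻¹' {i}) = c i) ∧
      c i₀ ≤ μ (idx ⁻¹' {i₀}) := by
  obtain ⟨f, hf⟩ := exists_injective_nat ι
  obtain ⟨S, hS, hdisj, hSc⟩ := hμ.exists_seq_disjoint (c := Function.extend f c 0)
    (by rw [tsum_extend_zero hf, measure_univ]; exact hc)
  have hSc' : ∀ i, μ (S (f i)) = c i := fun i => by rw [hSc, hf.extend_apply]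
  have huniq : ∀ {i j ω}, ω ∈ S (f i) → ω ∈ S (f j) → i = j := fun {i j ω} hi hj => by
    by_contra hij
    exact disjoint_left.1 (hdisj (hf.ne hij)) hi hj
  classical
  let idx : Ω → ι := fun ω => if h : ∃ i, ω ∈ S (f i) then h.choose else i₀
  have hidx : ∀ {i ω}, ω ∈ S (f i) → idx ω = i := fun {i ω} hi => by
    have h : ∃ i, ω ∈ S (f i) := ⟨i, hi⟩
    simp only [idx, dif_pos h]
    exact huniq h.choose_spec hi
  have hidx' : ∀ {ω}, idx ω ≠ i₀ → ω ∈ S (f (idx ω)) := fun {ω} h => by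
    by_cases h' : ∃ i, ω ∈ S (f i)
    · simp only [idx, dif_pos h']
      exact h'.choose_spec
    · exact absurd (by simp only [idx, dif_neg h']) h
  have hpre : ∀ i, i ≠ i₀ → idx ⁻¹' {i} = S (f i) := fun i hi => by
    ext ω
    refine ⟨fun h => ?_, fun h => hidx h⟩
    have h' : idx ω = i := h
    rw [← h']
    exact hidx' (h' ▸ hi)
  have hm : ∀ i, i ≠ i₀ → MeasurableSet (idx ⁻¹' {i}) := fun i hi => hpre i hi ▸ hS _
  have hm₀ : MeasurableSet (idx ⁻¹' {i₀}) := by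
    have : idx ⁻¹' {i₀} = (⋃ i : {i // i ≠ i₀}, idx ⁻¹' {i.1})ᶜ := by
      ext ω
      simp only [mem_preimage, mem_singleton_iff, mem_compl_iff, mem_iUnion, Subtype.exists,
        exists_prop, not_exists, not_and]
      exact ⟨fun h i hi h' => hi (h'.symm.trans h), fun h => by_contra fun h' => h _ h' rfl⟩
    rw [this]
    exact (MeasurableSet.iUnion fun i : {i // i ≠ i₀} => hm i.1 i.2).compl
  refine ⟨idx, fun s => ?_, fun i hi => by rw [hpre i hi, hSc'], ?_⟩
  · rw [← biUnion_preimage_singleton]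
    refine MeasurableSet.biUnion s.to_countable fun i _ => ?_
    by_cases hi : i = i₀
    · exact hi ▸ hm₀
    · exact hm i hi
  · rw [← hSc']
    exact measure_mono fun ω h => hidx h

end Nonatomic

end Orlicz

namespace Orlicz

/-! ### Heights and cell sizes from the failure of `Δ₂`. -/

section Growth

variable {Φ : ℝ → ℝ}

theorem IsSuperlinear.tendsto_atTop (hlim : IsSuperlinear Φ) : Tendsto Φ atTop atTop := by
  refine tendsto_atTop_mono' atTop ?_ tendsto_id
  filter_upwards [hlim.eventually_ge_atTop 1, eventually_gt_atTop 0] with t ht ht0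
  rwa [le_div_iff₀ ht0, one_mul] at ht

theorem IsOrliczFunction.tendsto_conjugate_atTop (hΦ : IsOrliczFunction Φ)
    (hlim : IsSuperlinear Φ) : Tendsto (Orlicz.conjugate Φ) atTop atTop := by
  refine tendsto_atTop_mono (fun s => ?_) (tendsto_atTop_add_const_right atTop (-Φ 1) tendsto_id)
  have := hΦ.young hlim zero_le_one s
  simpa [sub_eq_add_neg] using this

theorem exists_ge_of_not_deltaTwo (h : ¬ DeltaTwo Φ) (hinf : Tendsto Φ atTop atTop) (k : ℝ) :
    ∃ t, 0 < t ∧ k ≤ Φ (2 * t) ∧ k * Φ t ≤ Φ (2 * t) := by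
  obtain ⟨T, hT⟩ := eventually_atTop.1 (hinf.eventually_ge_atTop k)
  simp only [DeltaTwo, not_exists, not_and, not_forall, not_lt] at h
  obtain ⟨t, ht, hle⟩ := h (max T 1) (by positivity) k
  have ht0 : 0 < t := lt_of_lt_of_le (by positivity) ht
  exact ⟨t, ht0, hT _ (((le_max_left _ _).trans ht).trans (by linarith)), hle⟩

/-- On a cell of measure `c`, the height `t` costs almost no modular, while twice that height costs
`2`. The failure of `Δ₂` is used with ratio `2 / δ`, and `c = 2 / Φ (2 t)`. -/
theorem exists_height_of_not_deltaTwo (h : ¬ DeltaTwo Φ) (hinf : Tendsto Φ atTop atTop) {δ : ℝ}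
    (hδ : 0 < δ) :
    ∃ t c, 0 < t ∧ 0 < c ∧ c ≤ δ ∧ Φ t * c ≤ δ ∧ Φ (2 * t) * c = 2 := by
  obtain ⟨t, ht, h1, h2⟩ := exists_ge_of_not_deltaTwo h hinf (2 / δ)
  have hpos : 0 < Φ (2 * t) := lt_of_lt_of_le (by positivity) h1
  rw [div_le_iff₀ hδ] at h1
  rw [div_mul_eq_mul_div, div_le_iff₀ hδ] at h2
  refine ⟨t, 2 / Φ (2 * t), ht, by positivity, ?_, ?_, by field_simp⟩
  · rw [div_le_iff₀ hpos]; linarith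
  · rw [mul_div_assoc', div_le_iff₀ hpos]; linarith

/-- On a cell of measure `c`, the height `s` has `Φ`-modular at most `1` and `r` has tiny
`Ψ`-modular, yet their product integrates to `1 / 2`. Here `Ψ r` is tiny compared with `Ψ (2 r)`,
and `s` nearly attains the supremum defining `Ψ (2 r)`. -/
theorem IsOrliczFunction.exists_heights_of_not_deltaTwo_conjugate (hΦ : IsOrliczFunction Φ)
    (hlim : IsSuperlinear Φ) (h : ¬ DeltaTwo (Orlicz.conjugate Φ)) {δ : ℝ} (hδ : 0 < δ) :
    ∃ s r c, 0 < s ∧ 0 < r ∧ 0 < c ∧ c ≤ δ ∧ Φ s * c ≤ 1 ∧ Orlicz.conjugate Φ r * c ≤ δ ∧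
      s * r * c = 1 / 2 := by
  obtain ⟨r, hr, h1, h2⟩ := exists_ge_of_not_deltaTwo h (hΦ.tendsto_conjugate_atTop hlim) (2 / δ)
  have hpos : 0 < Orlicz.conjugate Φ (2 * r) := lt_of_lt_of_le (by positivity) h1
  obtain ⟨_, ⟨s, hs, rfl⟩, hlt⟩ := exists_lt_of_lt_csSup
    (⟨_, 0, mem_Ici.2 le_rfl, rfl⟩ : ((fun t : ℝ => t * (2 * r) - Φ t) '' Ici 0).Nonempty)
    (half_lt_self hpos)
  have hs0 : 0 ≤ s := hs
  have hΦs := hΦ.nonneg hs0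
  have hsr : Orlicz.conjugate Φ (2 * r) / 2 < s * (2 * r) - Φ s := hlt
  have hs' : 0 < s := by
    rcases hs0.eq_or_lt with h0 | h0
    · rw [← h0] at hsr hΦs
      linarith
    · exact h0
  rw [div_le_iff₀ hδ] at h1
  rw [div_mul_eq_mul_div, div_le_iff₀ hδ] at h2
  have hp : 0 < 2 * r * s := by positivity
  have hmul : Orlicz.conjugate Φ (2 * r) / 2 * δ ≤ 2 * r * s * δ :=
    mul_le_mul_of_nonneg_right (by linarith) hδ.le
  -- From `Ψ (2 r) / 2 < 2 r s - Φ s`, the number `2 r s` exceeds both `Φ s` and `Ψ (2 r) / 2`, so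
  -- this cell size meets all the bounds.
  refine ⟨s, r, 1 / (2 * r * s), hs', hr, by positivity, ?_, ?_, ?_, by field_simp⟩
  · rw [div_le_iff₀ hp]; linarith
  · rw [mul_one_div, div_le_iff₀ hp]; linarith
  · rw [mul_one_div, div_le_iff₀ hp]; linarith

end Growth

/-! ### The adapted partition. -/

/-- The index set of the partition of `Ω` on which the counterexample lives. -/
inductive Cell
  | rest : Cell
  | base : Cell
  | tail (n : ℕ) : Cell
  | grid (p : ℕ × ℕ) : Cell

namespace Cell

instance : MeasurableSpace Cell := ⊤

instance : DiscreteMeasurableSpace Cell := ⟨fun _ => trivial⟩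

instance : Countable Cell := by
  let f : Cell → Option (Option (ℕ ⊕ ℕ × ℕ)) := fun i => match i with
    | rest => none
    | base => some none
    | tail n => some (some (Sum.inl n))
    | grid p => some (some (Sum.inr p))
  refine Function.Injective.countable (f := f) fun i j h => ?_
  cases i <;> cases j <;> simp_all [f]

theorem tail_injective : Function.Injective tail := fun _ _ h => by injection h

theorem grid_injective : Function.Injective grid := fun _ _ h => by injection h

end Cell

/-- A partition of `Ω` adapted to `Φ`.  The random variable with value `t n` on `tail n` belongs to
`L^Φ`, but twice its tails all have modular greater than `1`; the random variables with value
`s p` on `grid p` are bounded in `L^Φ`, while the one with value `r p` on each `grid p` lies in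
`L^Ψ`. -/
structure CellPartition {Ω : Type*} [MeasurableSpace Ω] (Φ : ℝ → ℝ) (μ : Measure Ω) where
  idx : Ω → Cell
  measurable_idx : Measurable idx
  t : ℕ → ℝ
  s : ℕ × ℕ → ℝ
  r : ℕ × ℕ → ℝ
  t_pos : ∀ n, 0 < t n
  s_pos : ∀ p, 0 < s p
  r_pos : ∀ p, 0 < r p
  measure_ne_zero : ∀ i, μ (idx ⁻¹' {i}) ≠ 0
  one_lt_tail : ∀ n, 1 < ENNReal.ofReal (Φ (2 * t n)) * μ (idx ⁻¹' {Cell.tail n})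
  tsum_tail_le : ∑' n, ENNReal.ofReal (Φ (t n)) * μ (idx ⁻¹' {Cell.tail n}) ≤ 1
  grid_le : ∀ p, ENNReal.ofReal (Φ (s p)) * μ (idx ⁻¹' {Cell.grid p}) ≤ 1
  tsum_grid_le : ∑' p, ENNReal.ofReal (conjugate Φ (r p)) * μ (idx ⁻¹' {Cell.grid p}) ≤ 1
  mul_measure_grid : ∀ p, s p * r p * μ.real (idx ⁻¹' {Cell.grid p}) = 1 / 2

section Construction

variable {Ω : Type*} [MeasurableSpace Ω] {μ : Measure Ω} {Φ : ℝ → ℝ}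

theorem IsNonatomic.nonempty_cellPartition [IsProbabilityMeasure μ] (hμ : IsNonatomic μ)
    (hΦ : IsOrliczFunction Φ) (hlim : IsSuperlinear Φ) (hΦ₂ : ¬ DeltaTwo Φ)
    (hΨ₂ : ¬ DeltaTwo (conjugate Φ)) : Nonempty (CellPartition Φ μ) := by
  -- One summable budget serves twice: it bounds the cell measures and the modular contributions of
  -- the tail heights and of the dual variable.
  obtain ⟨δ, hδ, hδsum⟩ := ENNReal.exists_pos_sum_of_countable (one_ne_zero (α := ℝ≥0∞)) Cell
  have hδ' : ∀ i, (0 : ℝ) < δ i := fun i => hδ i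
  choose t c ht hc hcδ hΦt hΦt2 using fun n =>
    exists_height_of_not_deltaTwo hΦ₂ hlim.tendsto_atTop (hδ' (Cell.tail n))
  choose s r d hs hr hd hdδ hΦs hΨr hsr using fun p =>
    hΦ.exists_heights_of_not_deltaTwo_conjugate hlim hΨ₂ (hδ' (Cell.grid p))
  let m : Cell → ℝ := fun i => match i with
    | .rest => δ .rest
    | .base => δ .base
    | .tail n => c n
    | .grid p => d p
  have hm : ∀ i, 0 < m i := fun i => by
    cases i with
    | rest => exact hδ' _
    | base => exact hδ' _
    | tail n => exact hc n
    | grid p => exact hd p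
  have hmδ : ∀ i, m i ≤ δ i := fun i => by
    cases i with
    | rest => exact le_rfl
    | base => exact le_rfl
    | tail n => exact hcδ n
    | grid p => exact hdδ p
  have hsum : ∑' i, ENNReal.ofReal (m i) ≤ 1 :=
    (ENNReal.tsum_le_tsum fun i => ENNReal.ofReal_le_of_le_toReal (hmδ i)).trans hδsum.le
  obtain ⟨idx, hidx, hne, hrest⟩ := hμ.exists_partition Cell.rest hsum
  have hmt : ∀ n, μ (idx ⁻¹' {Cell.tail n}) = ENNReal.ofReal (c n) := fun n => hne _ nofun
  have hmg : ∀ p, μ (idx ⁻¹' {Cell.grid p}) = ENNReal.ofReal (d p) := fun p => hne _ nofun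
  exact ⟨{
    idx := idx
    measurable_idx := fun s _ => hidx s
    t := t
    s := s
    r := r
    t_pos := ht
    s_pos := hs
    r_pos := hr
    measure_ne_zero := fun i => by
      have h0 : 0 < ENNReal.ofReal (m i) := ENNReal.ofReal_pos.2 (hm i)
      by_cases hi : i = Cell.rest
      · subst hi
        exact (h0.trans_le hrest).ne'
      · rw [hne i hi]
        exact h0.ne'
    one_lt_tail := fun n => by
      rw [hmt, ← ENNReal.ofReal_mul (hΦ.nonneg (by linarith [ht n])), hΦt2]
      simp
    tsum_tail_le := by
      refine le_trans (ENNReal.tsum_le_tsum fun n => ?_)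
        ((ENNReal.tsum_comp_le_tsum_of_injective Cell.tail_injective _).trans hδsum.le)
      rw [hmt, ← ENNReal.ofReal_mul (hΦ.nonneg (ht n).le)]
      exact ENNReal.ofReal_le_of_le_toReal (hΦt n)
    grid_le := fun p => by
      rw [hmg, ← ENNReal.ofReal_mul (hΦ.nonneg (hs p).le), ENNReal.ofReal_le_one]
      exact hΦs p
    tsum_grid_le := by
      refine le_trans (ENNReal.tsum_le_tsum fun p => ?_)
        ((ENNReal.tsum_comp_le_tsum_of_injective Cell.grid_injective _).trans hδsum.le)
      rw [hmg, ← ENNReal.ofReal_mul ((hΦ.conjugate hlim).nonneg (hr p).le)]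
      exact ENNReal.ofReal_le_of_le_toReal (hΨr p)
    mul_measure_grid := fun p => by
      rw [measureReal_def, hmg, ENNReal.toReal_ofReal (hd p).le]
      exact hsr p }⟩

end Construction

/-! ### Membership in `L^Φ`, pairings and weak convergence. -/

section Membership

variable {Ω : Type*} [MeasurableSpace Ω] {μ : Measure Ω} {Φ : ℝ → ℝ}

theorem mem_orliczSpace_iff {hΦ : IsOrliczFunction Φ} {X : Ω →ₘ[μ] ℝ} :
    X ∈ orliczSpace Φ hΦ μ ↔ ∃ l : ℝ, 0 < l ∧ modular Φ X l ≤ 1 :=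
  luxemburgNorm_lt_top_iff

theorem mem_orliczSpace_of_abs_le (hΦ : IsOrliczFunction Φ) {X Y : Ω →ₘ[μ] ℝ}
    (hY : Y ∈ orliczSpace Φ hΦ μ) (h : ∀ᵐ ω ∂μ, |X ω| ≤ |Y ω|) : X ∈ orliczSpace Φ hΦ μ := by
  obtain ⟨l, hl, hYl⟩ := mem_orliczSpace_iff.1 hY
  refine mem_orliczSpace_iff.2 ⟨l, hl, le_trans (lintegral_mono_ae ?_) hYl⟩
  filter_upwards [h] with ω hω
  refine ENNReal.ofReal_le_ofReal (hΦ.monotoneOn (mem_Ici.2 ?_) (mem_Ici.2 ?_) ?_)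
  · positivity
  · positivity
  · gcongr

/-- Evaluation `X ↦ 𝔼[X Y]` at an element of the dual Orlicz space. -/
noncomputable def pairing (hΦ : IsOrliczFunction Φ) (hlim : IsSuperlinear Φ)
    (Y : orliczSpace (conjugate Φ) (hΦ.conjugate hlim) μ) : orliczSpace Φ hΦ μ →ₗ[ℝ] ℝ where
  toFun X := ∫ ω, (X : Ω →ₘ[μ] ℝ) ω * (Y : Ω →ₘ[μ] ℝ) ω ∂μ
  map_add' X X' := by
    rw [← integral_add (integrable_mul hΦ hlim X Y) (integrable_mul hΦ hlim X' Y)]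
    refine integral_congr_ae ?_
    filter_upwards [AEEqFun.coeFn_add (X : Ω →ₘ[μ] ℝ) (X' : Ω →ₘ[μ] ℝ)] with ω hω
    rw [Submodule.coe_add, hω, Pi.add_apply, add_mul]
  map_smul' a X := by
    rw [RingHom.id_apply, smul_eq_mul, ← integral_const_mul]
    refine integral_congr_ae ?_
    filter_upwards [AEEqFun.coeFn_smul a (X : Ω →ₘ[μ] ℝ)] with ω hω
    rw [Submodule.coe_smul, hω, Pi.smul_apply, smul_eq_mul, mul_assoc]

/-- Hölder's inequality for random variables of modular at most `1`. -/
theorem exists_abs_pairing_le (hΦ : IsOrliczFunction Φ) (hlim : IsSuperlinear Φ)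
    (Y : orliczSpace (conjugate Φ) (hΦ.conjugate hlim) μ) :
    ∃ K, ∀ X : orliczSpace Φ hΦ μ, modular Φ (X : Ω →ₘ[μ] ℝ) 1 ≤ 1 →
      |pairing hΦ hlim Y X| ≤ K := by
  obtain ⟨m, hm, hYm⟩ := mem_orliczSpace_iff.1 Y.2
  refine ⟨m * 2, fun X hX => ?_⟩
  have key : ∀ᵐ ω ∂μ, ENNReal.ofReal |(X : Ω →ₘ[μ] ℝ) ω * (Y : Ω →ₘ[μ] ℝ) ω| ≤
      ENNReal.ofReal m * (ENNReal.ofReal (Φ (|(X : Ω →ₘ[μ] ℝ) ω| / 1)) +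
        ENNReal.ofReal (conjugate Φ (|(Y : Ω →ₘ[μ] ℝ) ω| / m))) := by
    refine Eventually.of_forall fun ω => ?_
    have h1 : 0 ≤ Φ (|(X : Ω →ₘ[μ] ℝ) ω| / 1) := hΦ.nonneg (by positivity)
    have h2 : 0 ≤ conjugate Φ (|(Y : Ω →ₘ[μ] ℝ) ω| / m) :=
      (hΦ.conjugate hlim).nonneg (by positivity)
    rw [← ENNReal.ofReal_add h1 h2, ← ENNReal.ofReal_mul hm.le]
    refine ENNReal.ofReal_le_ofReal ?_
    have h := hΦ.young hlim (show 0 ≤ |(X : Ω →ₘ[μ] ℝ) ω| / 1 by positivity)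
      (|(Y : Ω →ₘ[μ] ℝ) ω| / m)
    have e : |(X : Ω →ₘ[μ] ℝ) ω * (Y : Ω →ₘ[μ] ℝ) ω| =
        m * (|(X : Ω →ₘ[μ] ℝ) ω| / 1 * (|(Y : Ω →ₘ[μ] ℝ) ω| / m)) := by
      rw [abs_mul]; field_simp
    rw [e]
    exact mul_le_mul_of_nonneg_left (by linarith) hm.le
  have hle := lintegral_mono_ae key
  rw [lintegral_const_mul' _ _ ENNReal.ofReal_ne_top,
    lintegral_add_left' (hΦ.aemeasurable _ one_pos).ennreal_ofReal] at hle
  have hle2 : ∫⁻ ω, ENNReal.ofReal |(X : Ω →ₘ[μ] ℝ) ω * (Y : Ω →ₘ[μ] ℝ) ω| ∂μ ≤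
      ENNReal.ofReal (m * 2) := by
    refine hle.trans ?_
    rw [ENNReal.ofReal_mul hm.le]
    gcongr
    calc _ ≤ (1 : ℝ≥0∞) + 1 := add_le_add hX hYm
      _ = ENNReal.ofReal 2 := by norm_num
  calc |pairing hΦ hlim Y X| ≤ ∫ ω, |(X : Ω →ₘ[μ] ℝ) ω * (Y : Ω →ₘ[μ] ℝ) ω| ∂μ :=
        abs_integral_le_integral_abs
    _ ≤ m * 2 := by
        rw [integral_eq_lintegral_of_nonneg_ae (Eventually.of_forall fun ω => abs_nonneg _)
          (integrable_mul hΦ hlim X Y).abs.aestronglyMeasurable]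
        exact ENNReal.toReal_le_of_le_ofReal (by positivity) hle2

/-- Convergence in the weak topology is convergence of all pairings. -/
theorem tendsto_weakTopology {hΦ : IsOrliczFunction Φ} {hlim : IsSuperlinear Φ} {ι : Type*}
    {l : Filter ι} {X : ι → orliczSpace Φ hΦ μ} {X' : orliczSpace Φ hΦ μ}
    (h : ∀ Y, Tendsto (fun i => pairing hΦ hlim Y (X i)) l (𝓝 (pairing hΦ hlim Y X'))) :
    Tendsto X l (@nhds _ (weakTopology (orliczSpace Φ hΦ μ)
      (orliczSpace (conjugate Φ) (hΦ.conjugate hlim) μ)) X') := by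
  rw [weakTopology, nhds_iInf, tendsto_iInf]
  intro Y
  rw [nhds_induced, tendsto_comap_iff]
  exact h Y

theorem exists_mem_of_ae {s : Set Ω} (hs : μ s ≠ 0) {q : Ω → Prop} (hq : ∀ᵐ ω ∂μ, q ω) :
    ∃ ω ∈ s, q ω := by
  by_contra! h
  exact hs (measure_mono_null h (ae_iff.1 hq))

end Membership

end Orlicz

namespace Orlicz

/-! ### Random variables constant on cells. -/

namespace CellPartition

variable {Ω : Type*} [MeasurableSpace Ω] {μ : Measure Ω} {Φ : ℝ → ℝ}

/-- The part of `Ω` with index `i`. -/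
def cell (P : CellPartition Φ μ) (i : Cell) : Set Ω :=
  P.idx ⁻¹' {i}

theorem measurableSet_cell (P : CellPartition Φ μ) (i : Cell) : MeasurableSet (P.cell i) :=
  P.measurable_idx trivial

theorem disjoint_cell (P : CellPartition Φ μ) {i j : Cell} (h : i ≠ j) :
    Disjoint (P.cell i) (P.cell j) :=
  disjoint_left.2 fun _ hi hj => h (hi.symm.trans hj)

theorem exists_mem_cell (P : CellPartition Φ μ) (i : Cell) {q : Ω → Prop} (hq : ∀ᵐ ω ∂μ, q ω) :
    ∃ ω, P.idx ω = i ∧ q ω :=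
  exists_mem_of_ae (P.measure_ne_zero i) hq

theorem lintegral_comp_idx (P : CellPartition Φ μ) (f : Cell → ℝ≥0∞) :
    ∫⁻ ω, f (P.idx ω) ∂μ = ∑' i, f i * μ (P.cell i) := by
  rw [← lintegral_map (f := f) (Measurable.of_discrete) P.measurable_idx, lintegral_countable']
  refine tsum_congr fun i => ?_
  rw [Measure.map_apply P.measurable_idx (measurableSet_singleton i)]
  rfl

/-- The random variable with value `v i` on the cell `i`. -/
noncomputable def cellVar (P : CellPartition Φ μ) (v : Cell → ℝ) : Ω →ₘ[μ] ℝ :=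
  AEEqFun.mk (fun ω => v (P.idx ω))
    ((Measurable.of_discrete (f := v)).comp P.measurable_idx).aestronglyMeasurable

theorem coeFn_cellVar (P : CellPartition Φ μ) (v : Cell → ℝ) :
    ∀ᵐ ω ∂μ, P.cellVar v ω = v (P.idx ω) :=
  AEEqFun.coeFn_mk _ _

theorem modular_cellVar (P : CellPartition Φ μ) (Θ : ℝ → ℝ) (v : Cell → ℝ) :
    modular Θ (P.cellVar v) 1 = ∑' i, ENNReal.ofReal (Θ |v i|) * μ (P.cell i) := by
  rw [← P.lintegral_comp_idx fun i => ENNReal.ofReal (Θ |v i|)]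
  refine lintegral_congr_ae ?_
  filter_upwards [P.coeFn_cellVar v] with ω hω
  rw [hω, div_one]

theorem modular_cellVar_of_range (P : CellPartition Φ μ) {Θ : ℝ → ℝ} (hΘ : Θ 0 = 0)
    {v : Cell → ℝ} {ι : Type*} {g : ι → Cell} (hg : Function.Injective g)
    (hv : ∀ i, v i ≠ 0 → i ∈ range g) :
    modular Θ (P.cellVar v) 1 = ∑' k, ENNReal.ofReal (Θ |v (g k)|) * μ (P.cell (g k)) := by
  rw [modular_cellVar]
  refine (hg.tsum_eq (f := fun i => ENNReal.ofReal (Θ |v i|) * μ (P.cell i)) ?_).symm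
  intro i hi
  refine hv i fun h0 => hi ?_
  simp [h0, hΘ]

/-- The value `-1` on the base cell. -/
def baseVal : Cell → ℝ
  | .base => -1
  | _ => 0

/-- The values `t j` on the cells `tail j`, `n ≤ j`. -/
def tailVal (P : CellPartition Φ μ) (n : ℕ) : Cell → ℝ
  | .tail j => if n ≤ j then P.t j else 0
  | _ => 0

/-- The value `s p` on the cell `grid p`. -/
def gridVal (P : CellPartition Φ μ) (p : ℕ × ℕ) : Cell → ℝ
  | .grid q => if q = p then P.s q else 0
  | _ => 0

/-- The values `r p` on the cells `grid p`. -/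
def dualVal (P : CellPartition Φ μ) : Cell → ℝ
  | .grid p => P.r p
  | _ => 0

theorem tailVal_zero_mem (P : CellPartition Φ μ) (hΦ : IsOrliczFunction Φ) :
    P.cellVar (P.tailVal 0) ∈ orliczSpace Φ hΦ μ := by
  refine mem_orliczSpace_iff.2 ⟨1, one_pos, ?_⟩
  rw [P.modular_cellVar_of_range hΦ.map_zero Cell.tail_injective]
  · refine le_trans (le_of_eq (tsum_congr fun n => ?_)) P.tsum_tail_le
    simp [tailVal, abs_of_pos (P.t_pos n), cell]
  · intro i hi
    cases i <;> simp_all [tailVal]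

theorem tailVal_mem (P : CellPartition Φ μ) (hΦ : IsOrliczFunction Φ) (n : ℕ) :
    P.cellVar (P.tailVal n) ∈ orliczSpace Φ hΦ μ := by
  refine mem_orliczSpace_of_abs_le hΦ (P.tailVal_zero_mem hΦ) ?_
  filter_upwards [P.coeFn_cellVar (P.tailVal n), P.coeFn_cellVar (P.tailVal 0)] with ω h1 h2
  rw [h1, h2]
  cases P.idx ω with
  | tail j =>
    by_cases h : n ≤ j <;> simp [tailVal, h]
  | _ => simp [tailVal]

theorem modular_gridVal_le (P : CellPartition Φ μ) (hΦ : IsOrliczFunction Φ) (p : ℕ × ℕ) :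
    modular Φ (P.cellVar (P.gridVal p)) 1 ≤ 1 := by
  rw [P.modular_cellVar_of_range hΦ.map_zero Cell.grid_injective,
    tsum_eq_single p fun q hq => ?_]
  · simpa [gridVal, abs_of_pos (P.s_pos p), cell] using P.grid_le p
  · simp [gridVal, hq, hΦ.map_zero]
  · intro i hi
    cases i <;> simp_all [gridVal]

theorem gridVal_mem (P : CellPartition Φ μ) (hΦ : IsOrliczFunction Φ) (p : ℕ × ℕ) :
    P.cellVar (P.gridVal p) ∈ orliczSpace Φ hΦ μ :=
  mem_orliczSpace_iff.2 ⟨1, one_pos, P.modular_gridVal_le hΦ p⟩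

theorem baseVal_mem [IsProbabilityMeasure μ] (P : CellPartition Φ μ) (hΦ : IsOrliczFunction Φ) :
    P.cellVar baseVal ∈ orliczSpace Φ hΦ μ := by
  refine mem_orliczSpace_of_abs_le hΦ (one_mem_orliczSpace hΦ μ) ?_
  filter_upwards [P.coeFn_cellVar baseVal, AEEqFun.coeFn_one (α := Ω) (β := ℝ) (μ := μ)]
    with ω h1 h2
  rw [h1, h2]
  cases P.idx ω <;> simp [baseVal]

theorem dualVal_mem (P : CellPartition Φ μ) (hΨ : IsOrliczFunction (conjugate Φ)) :
    P.cellVar P.dualVal ∈ orliczSpace (conjugate Φ) hΨ μ := by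
  refine mem_orliczSpace_iff.2 ⟨1, one_pos, ?_⟩
  rw [P.modular_cellVar_of_range hΨ.map_zero Cell.grid_injective]
  · refine le_trans (le_of_eq (tsum_congr fun p => ?_)) P.tsum_grid_le
    simp [dualVal, abs_of_pos (P.r_pos p), cell]
  · intro i hi
    cases i <;> simp_all [dualVal]

/-! ### Combinations of the generators and the cone. -/

/-- The value on each cell of the combination, with coefficients `a p`, of the random variables
that are `-1` on `base`, `(p.1 + 1) t j` on `tail j` for `j ≥ p.2`, and `s p / (p.1 + 1)` on
`grid p`. -/
noncomputable def floor (P : CellPartition Φ μ) (a : ℕ × ℕ → ℝ) : Cell → ℝ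
  | .rest => 0
  | .base => -∑' p, a p
  | .tail j => (∑' p : ℕ × ℕ, if p.2 ≤ j then ((p.1 : ℝ) + 1) * a p else 0) * P.t j
  | .grid p => ((p.1 : ℝ) + 1)⁻¹ * a p * P.s p

/-- The coefficient families whose combinations are well defined. -/
structure IsCoeff (a : ℕ × ℕ → ℝ) : Prop where
  nonneg : ∀ p, 0 ≤ a p
  summable_mul : Summable fun p : ℕ × ℕ => ((p.1 : ℝ) + 1) * a p

theorem IsCoeff.weighted_nonneg {a : ℕ × ℕ → ℝ} (ha : IsCoeff a) (p : ℕ × ℕ) :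
    0 ≤ ((p.1 : ℝ) + 1) * a p :=
  mul_nonneg (by positivity) (ha.nonneg p)

theorem IsCoeff.le_mul {a : ℕ × ℕ → ℝ} (ha : IsCoeff a) (p : ℕ × ℕ) :
    a p ≤ ((p.1 : ℝ) + 1) * a p :=
  le_mul_of_one_le_left (ha.nonneg p) (by linarith [p.1.cast_nonneg (α := ℝ)])

theorem IsCoeff.summable {a : ℕ × ℕ → ℝ} (ha : IsCoeff a) : Summable a :=
  ha.summable_mul.of_nonneg_of_le ha.nonneg ha.le_mul

theorem IsCoeff.summable_ite {a : ℕ × ℕ → ℝ} (ha : IsCoeff a) (j : ℕ) :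
    Summable fun p : ℕ × ℕ => if p.2 ≤ j then ((p.1 : ℝ) + 1) * a p else 0 := by
  refine ha.summable_mul.of_nonneg_of_le (fun p => ?_) fun p => ?_
  · split_ifs
    exacts [ha.weighted_nonneg p, le_rfl]
  · split_ifs
    exacts [le_rfl, ha.weighted_nonneg p]

theorem IsCoeff.add {a b : ℕ × ℕ → ℝ} (ha : IsCoeff a) (hb : IsCoeff b) : IsCoeff (a + b) where
  nonneg p := add_nonneg (ha.nonneg p) (hb.nonneg p)
  summable_mul := by
    simpa only [Pi.add_apply, mul_add] using ha.summable_mul.add hb.summable_mul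

theorem IsCoeff.smul {a : ℕ × ℕ → ℝ} (ha : IsCoeff a) {l : ℝ} (hl : 0 ≤ l) : IsCoeff (l • a) where
  nonneg p := mul_nonneg hl (ha.nonneg p)
  summable_mul := by
    simpa only [Pi.smul_apply, smul_eq_mul, mul_left_comm] using ha.summable_mul.mul_left l

theorem isCoeff_single (p : ℕ × ℕ) : IsCoeff (Pi.single p 1) where
  nonneg q := by
    rw [Pi.single_apply]
    split_ifs <;> norm_num
  summable_mul := by
    refine summable_of_ne_finset_zero (s := {p}) fun q hq => ?_
    rw [Pi.single_eq_of_ne (by simpa using hq), mul_zero]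

theorem floor_add (P : CellPartition Φ μ) {a b : ℕ × ℕ → ℝ} (ha : IsCoeff a) (hb : IsCoeff b)
    (i : Cell) : P.floor (a + b) i = P.floor a i + P.floor b i := by
  cases i with
  | rest => simp [floor]
  | base =>
    simp only [floor, Pi.add_apply, ha.summable.tsum_add hb.summable]
    ring
  | tail j =>
    simp only [floor, ← add_mul, ← (ha.summable_ite j).tsum_add (hb.summable_ite j)]
    congr 1
    refine tsum_congr fun p => ?_
    split_ifs <;> simp [mul_add]
  | grid p => simp only [floor, Pi.add_apply]; ring

/-- No summability is needed: real scalars commute with `tsum` even when it takes its default value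
`0`. -/
theorem floor_smul (P : CellPartition Φ μ) (l : ℝ) (a : ℕ × ℕ → ℝ) (i : Cell) :
    P.floor (l • a) i = l * P.floor a i := by
  cases i with
  | rest => simp [floor]
  | base => simp [floor, tsum_mul_left]
  | tail j =>
    simp only [floor, ← mul_assoc, ← tsum_mul_left]
    congr 1
    refine tsum_congr fun p => ?_
    split_ifs
    · simp only [Pi.smul_apply, smul_eq_mul]; ring
    · simp
  | grid p => simp only [floor, Pi.smul_apply, smul_eq_mul]; ring

theorem floor_single (P : CellPartition Φ μ) (p : ℕ × ℕ) (i : Cell) :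
    P.floor (Pi.single p 1) i =
      baseVal i + ((p.1 : ℝ) + 1) * P.tailVal p.2 i + ((p.1 : ℝ) + 1)⁻¹ * P.gridVal p i := by
  cases i with
  | rest => simp [floor, baseVal, tailVal, gridVal]
  | base => simp [floor, baseVal, tailVal, gridVal, tsum_pi_single]
  | tail j =>
    simp only [floor, baseVal, tailVal, gridVal]
    rw [tsum_eq_single p fun q hq => by simp [hq]]
    split_ifs <;> simp
  | grid q =>
    by_cases h : q = p
    · subst h; simp [floor, baseVal, tailVal, gridVal]
    · simp [floor, baseVal, tailVal, gridVal, h]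

/-- The convex cone of the counterexample: all random variables dominating a combination. -/
def cone (P : CellPartition Φ μ) (hΦ : IsOrliczFunction Φ) : Set (orliczSpace Φ hΦ μ) :=
  {X | ∃ a, IsCoeff a ∧ ∀ᵐ ω ∂μ, P.floor a (P.idx ω) ≤ (X : Ω →ₘ[μ] ℝ) ω}

theorem isMonotone_cone (P : CellPartition Φ μ) (hΦ : IsOrliczFunction Φ) :
    IsMonotone (P.cone hΦ) := by
  rintro X₁ X₂ h ⟨a, ha, hX⟩
  refine ⟨a, ha, ?_⟩
  filter_upwards [h, hX] with ω h1 h2 using h2.trans h1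

theorem isPositivelyHomogeneous_cone (P : CellPartition Φ μ) (hΦ : IsOrliczFunction Φ) :
    IsPositivelyHomogeneous (P.cone hΦ) := by
  rintro l hl X ⟨a, ha, hX⟩
  refine ⟨l • a, ha.smul hl, ?_⟩
  filter_upwards [hX, AEEqFun.coeFn_smul l (X : Ω →ₘ[μ] ℝ)] with ω h1 h2
  rw [Submodule.coe_smul, h2, Pi.smul_apply, smul_eq_mul, floor_smul]
  exact mul_le_mul_of_nonneg_left h1 hl

theorem isAdditive_cone (P : CellPartition Φ μ) (hΦ : IsOrliczFunction Φ) :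
    IsAdditive (P.cone hΦ) := by
  rintro X ⟨a, ha, hX⟩ X' ⟨b, hb, hX'⟩
  refine ⟨a + b, ha.add hb, ?_⟩
  filter_upwards [hX, hX', AEEqFun.coeFn_add (X : Ω →ₘ[μ] ℝ) (X' : Ω →ₘ[μ] ℝ)] with ω h1 h2 h3
  rw [Submodule.coe_add, h3, Pi.add_apply, P.floor_add ha hb]
  exact add_le_add h1 h2

/-- Otherwise `X` would exceed every natural number on `rest`, a cell of positive measure. -/
theorem exists_sub_smul_one_notMem_cone [IsProbabilityMeasure μ] (P : CellPartition Φ μ)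
    (hΦ : IsOrliczFunction Φ) (X : orliczSpace Φ hΦ μ) :
    ∃ k : ℝ, X - k • one Φ hΦ μ ∉ P.cone hΦ := by
  by_contra! hall
  have key : ∀ n : ℕ, ∀ᵐ ω ∂μ, P.idx ω = Cell.rest → (n : ℝ) ≤ (X : Ω →ₘ[μ] ℝ) ω := by
    intro n
    obtain ⟨a, -, hX⟩ := hall n
    filter_upwards [hX, AEEqFun.coeFn_one (α := Ω) (β := ℝ) (μ := μ),
      AEEqFun.coeFn_smul (n : ℝ) (1 : Ω →ₘ[μ] ℝ),
      AEEqFun.coeFn_sub (X : Ω →ₘ[μ] ℝ) ((n : ℝ) • (1 : Ω →ₘ[μ] ℝ))] with ω h1 h2 h3 h4 hω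
    rw [Submodule.coe_sub, Submodule.coe_smul, one, h4, Pi.sub_apply, h3, Pi.smul_apply, h2,
      hω] at h1
    simp only [floor, Pi.one_apply, smul_eq_mul, mul_one] at h1
    linarith
  obtain ⟨ω, hω, h⟩ := P.exists_mem_cell Cell.rest (ae_all_iff.2 key)
  obtain ⟨n, hn⟩ := exists_nat_gt ((X : Ω →ₘ[μ] ℝ) ω)
  exact (h n hω).not_gt hn

theorem baseVal_notMem_cone [IsProbabilityMeasure μ] (P : CellPartition Φ μ)
    (hΦ : IsOrliczFunction Φ) : (⟨_, P.baseVal_mem hΦ⟩ : orliczSpace Φ hΦ μ) ∉ P.cone hΦ := by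
  rintro ⟨a, ha, hX⟩
  have hae : ∀ᵐ ω ∂μ, P.floor a (P.idx ω) ≤ baseVal (P.idx ω) := by
    filter_upwards [hX, P.coeFn_cellVar baseVal] with ω h1 h2
    rwa [h2] at h1
  have h0 : ∀ p, a p = 0 := by
    intro p
    obtain ⟨ω, hω, h⟩ := P.exists_mem_cell (Cell.grid p) hae
    rw [hω] at h
    simp only [floor, baseVal] at h
    refine le_antisymm ?_ (ha.nonneg p)
    by_contra! hpos
    have := P.s_pos p
    exact h.not_gt (by positivity)
  obtain ⟨ω, hω, h⟩ := P.exists_mem_cell Cell.base hae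
  rw [hω] at h
  simp [floor, baseVal, h0] at h
  linarith

/-! ### Failure of weak closedness. -/

theorem tendsto_pairing_tailVal (P : CellPartition Φ μ) (hΦ : IsOrliczFunction Φ)
    (hlim : IsSuperlinear Φ) (Y : orliczSpace (conjugate Φ) (hΦ.conjugate hlim) μ) :
    Tendsto (fun n => pairing hΦ hlim Y ⟨_, P.tailVal_mem hΦ n⟩) atTop (𝓝 0) := by
  have hae := ae_all_iff.2 fun n => P.coeFn_cellVar (P.tailVal n)
  have h := tendsto_integral_of_dominated_convergence (μ := μ) (f := fun _ => (0 : ℝ))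
    (F := fun n ω => P.cellVar (P.tailVal n) ω * (Y : Ω →ₘ[μ] ℝ) ω)
    (fun ω => |P.cellVar (P.tailVal 0) ω * (Y : Ω →ₘ[μ] ℝ) ω|)
    (fun n => (integrable_mul hΦ hlim ⟨_, P.tailVal_mem hΦ n⟩ Y).aestronglyMeasurable)
    (integrable_mul hΦ hlim ⟨_, P.tailVal_mem hΦ 0⟩ Y).abs ?_ ?_
  · rw [integral_zero] at h
    exact h
  · intro n
    filter_upwards [hae] with ω hω
    rw [Real.norm_eq_abs, abs_mul, abs_mul, hω, hω]
    refine mul_le_mul_of_nonneg_right ?_ (abs_nonneg _)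
    cases P.idx ω with
    | tail j => by_cases h : n ≤ j <;> simp [tailVal, h]
    | _ => simp [tailVal]
  · filter_upwards [hae] with ω hω
    refine tendsto_const_nhds.congr' ?_
    cases hi : P.idx ω with
    | tail j =>
      filter_upwards [eventually_gt_atTop j] with n hn
      simp [hω, hi, tailVal, hn.not_ge]
    | _ => exact Eventually.of_forall fun n => by simp [hω, hi, tailVal]

theorem not_isClosed_cone [IsProbabilityMeasure μ] (P : CellPartition Φ μ)
    (hΦ : IsOrliczFunction Φ) (hlim : IsSuperlinear Φ) :
    ¬ IsClosed[weakTopology (orliczSpace Φ hΦ μ)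
      (orliczSpace (conjugate Φ) (hΦ.conjugate hlim) μ)] (P.cone hΦ) := by
  intro hclosed
  let X₀ : orliczSpace Φ hΦ μ := ⟨_, P.baseVal_mem hΦ⟩
  let G : ℕ → orliczSpace Φ hΦ μ := fun n => ⟨_, P.tailVal_mem hΦ n⟩
  let E : ℕ × ℕ → orliczSpace Φ hΦ μ := fun p => ⟨_, P.gridVal_mem hΦ p⟩
  let X : ℕ × ℕ → orliczSpace Φ hΦ μ := fun p =>
    X₀ + ((p.1 : ℝ) + 1) • G p.2 + ((p.1 : ℝ) + 1)⁻¹ • E p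
  have hX : ∀ p, X p ∈ P.cone hΦ := by
    intro p
    refine ⟨Pi.single p 1, isCoeff_single p, ?_⟩
    filter_upwards [P.coeFn_cellVar baseVal, P.coeFn_cellVar (P.tailVal p.2),
      P.coeFn_cellVar (P.gridVal p),
      AEEqFun.coeFn_smul ((p.1 : ℝ) + 1) (G p.2 : Ω →ₘ[μ] ℝ),
      AEEqFun.coeFn_smul ((p.1 : ℝ) + 1)⁻¹ (E p : Ω →ₘ[μ] ℝ),
      AEEqFun.coeFn_add (X₀ : Ω →ₘ[μ] ℝ) (((p.1 : ℝ) + 1) • (G p.2 : Ω →ₘ[μ] ℝ)),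
      AEEqFun.coeFn_add ((X₀ : Ω →ₘ[μ] ℝ) + ((p.1 : ℝ) + 1) • (G p.2 : Ω →ₘ[μ] ℝ))
        (((p.1 : ℝ) + 1)⁻¹ • (E p : Ω →ₘ[μ] ℝ))] with ω h1 h2 h3 h4 h5 h6 h7
    simp only [X, Submodule.coe_add, Submodule.coe_smul]
    rw [h7, Pi.add_apply, h6, Pi.add_apply, h4, h5, Pi.smul_apply, Pi.smul_apply]
    simp only [X₀, G, E, smul_eq_mul]
    rw [h1, h2, h3, floor_single]
  -- The curried filter encodes the iterated limit: `n` is taken large depending on `m`, so that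
  -- `(m+1) G_n` is negligible despite its growing factor.
  have hconv : Tendsto X (atTop.curry atTop) (@nhds _ (weakTopology (orliczSpace Φ hΦ μ)
      (orliczSpace (conjugate Φ) (hΦ.conjugate hlim) μ)) X₀) := by
    refine tendsto_weakTopology (hlim := hlim) fun Y => ?_
    obtain ⟨K, hK⟩ := exists_abs_pairing_le hΦ hlim Y
    rw [Metric.tendsto_nhds]
    intro ε hε
    rw [eventually_curry_iff]
    have hlimK : Tendsto (fun m : ℕ => ((m : ℝ) + 1)⁻¹ * K) atTop (𝓝 0) := by
      simpa [one_div] using (tendsto_one_div_add_atTop_nhds_zero_nat (𝕜 := ℝ)).mul_const K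
    filter_upwards [hlimK.eventually_lt_const (half_pos hε)] with m hm
    have hlimG : Tendsto (fun n => |((m : ℝ) + 1) * pairing hΦ hlim Y (G n)|) atTop (𝓝 0) := by
      simpa using ((P.tendsto_pairing_tailVal hΦ hlim Y).const_mul ((m : ℝ) + 1)).abs
    filter_upwards [hlimG.eventually_lt_const (half_pos hε)] with n hn
    have hE : |((m : ℝ) + 1)⁻¹ * pairing hΦ hlim Y (E (m, n))| ≤ ((m : ℝ) + 1)⁻¹ * K := by
      rw [abs_mul, abs_of_pos (by positivity)]
      exact mul_le_mul_of_nonneg_left (hK _ (P.modular_gridVal_le hΦ _)) (by positivity)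
    simp only [X, map_add, map_smul, smul_eq_mul, Real.dist_eq]
    calc _ = |((m : ℝ) + 1) * pairing hΦ hlim Y (G n) +
          ((m : ℝ) + 1)⁻¹ * pairing hΦ hlim Y (E (m, n))| := by congr 1; ring
      _ ≤ _ := abs_add_le _ _
      _ < ε := by linarith
  have hne : (atTop.curry atTop : Filter (ℕ × ℕ)).NeBot := by
    rw [neBot_iff]
    intro hbot
    have hfalse : ∀ᶠ _ in (atTop.curry atTop : Filter (ℕ × ℕ)), False := by simp [hbot]
    rw [eventually_curry_iff] at hfalse
    obtain ⟨m, hm⟩ := hfalse.exists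
    exact hm.exists.choose_spec
  let := weakTopology (orliczSpace Φ hΦ μ) (orliczSpace (conjugate Φ) (hΦ.conjugate hlim) μ)
  exact P.baseVal_notMem_cone hΦ (hclosed.mem_of_tendsto hconv (Eventually.of_forall hX))

/-! ### Order closedness. -/

/-- Domination by an element of `L^Φ` bounds the coefficients through the tail cells. -/
theorem exists_tsum_le (P : CellPartition Φ μ) {hΦ : IsOrliczFunction Φ} (U : orliczSpace Φ hΦ μ) :
    ∃ K, ∀ a, IsCoeff a → (∀ᵐ ω ∂μ, P.floor a (P.idx ω) ≤ (U : Ω →ₘ[μ] ℝ) ω) →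
      ∑' p : ℕ × ℕ, ((p.1 : ℝ) + 1) * a p ≤ K := by
  obtain ⟨l, hl, hU⟩ := mem_orliczSpace_iff.1 U.2
  refine ⟨2 * l, fun a ha hae => Real.tsum_le_of_sum_le ha.weighted_nonneg fun F => ?_⟩
  by_contra! hF
  -- On `tail j` every generator indexed by `F` is already active, so a partial sum above `2 l`
  -- makes `U / l` at least `2 t j` there.
  set j := F.sup Prod.snd with hj
  have hle : 2 * l ≤ ∑' p : ℕ × ℕ, if p.2 ≤ j then ((p.1 : ℝ) + 1) * a p else 0 := by
    refine le_trans (hF.le.trans (le_of_eq (Finset.sum_congr rfl fun p hp => ?_)))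
      ((ha.summable_ite j).sum_le_tsum F fun p _ => ?_)
    · rw [if_pos (Finset.le_sup (f := Prod.snd) hp)]
    · split_ifs
      exacts [ha.weighted_nonneg p, le_rfl]
  have hlow : ENNReal.ofReal (Φ (2 * P.t j)) * μ (P.cell (Cell.tail j)) ≤
      modular Φ (U : Ω →ₘ[μ] ℝ) l := by
    rw [← setLIntegral_const]
    refine le_trans (lintegral_mono_ae ?_) (setLIntegral_le_lintegral (P.cell (Cell.tail j)) _)
    rw [ae_restrict_iff' (P.measurableSet_cell _)]
    filter_upwards [hae] with ω h hω
    have hω' : P.idx ω = Cell.tail j := hω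
    rw [hω'] at h
    simp only [floor] at h
    have ht := P.t_pos j
    have h1 : 2 * P.t j ≤ |(U : Ω →ₘ[μ] ℝ) ω| / l := by
      rw [le_div_iff₀ hl]
      calc 2 * P.t j * l = 2 * l * P.t j := by ring
        _ ≤ _ := mul_le_mul_of_nonneg_right hle ht.le
        _ ≤ _ := h
        _ ≤ _ := le_abs_self _
    exact ENNReal.ofReal_le_ofReal (hΦ.monotoneOn (mem_Ici.2 (by positivity))
      (mem_Ici.2 (by positivity)) h1)
  exact ((P.one_lt_tail j).trans_le (hlow.trans hU)).false

/-- Domination by an element of `L^Φ` bounds the coefficients through the grid cells. -/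
theorem exists_summable_bound (P : CellPartition Φ μ) {hΦ : IsOrliczFunction Φ}
    [IsFiniteMeasure μ] (hlim : IsSuperlinear Φ) (U : orliczSpace Φ hΦ μ) :
    ∃ u : ℕ × ℕ → ℝ, (∀ p, 0 ≤ u p) ∧ Summable u ∧ ∀ a, IsCoeff a →
      (∀ᵐ ω ∂μ, P.floor a (P.idx ω) ≤ (U : Ω →ₘ[μ] ℝ) ω) →
        ∀ p, a p ≤ ((p.1 : ℝ) + 1) * u p := by
  let H : orliczSpace (conjugate Φ) (hΦ.conjugate hlim) μ := ⟨_, P.dualVal_mem _⟩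
  have hint := (integrable_mul hΦ hlim U H).abs
  -- Summable because the grid cells are disjoint and `U H` is integrable; the factor `2` offsets `s
  -- p * r p * μ(grid p) = 1 / 2`.
  refine ⟨fun p => 2 * ∫ ω in P.cell (Cell.grid p),
    |(U : Ω →ₘ[μ] ℝ) ω * (H : Ω →ₘ[μ] ℝ) ω| ∂μ, fun p => ?_, ?_, fun a ha hae p => ?_⟩
  · exact mul_nonneg zero_le_two (integral_nonneg fun ω => abs_nonneg _)
  · refine Summable.mul_left 2 (hasSum_integral_iUnion (fun p => P.measurableSet_cell _) ?_
      hint.integrableOn).summable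
    exact fun p q hpq => P.disjoint_cell (Cell.grid_injective.ne hpq)
  · have hlow : ∫ _ in P.cell (Cell.grid p), ((p.1 : ℝ) + 1)⁻¹ * a p * P.s p * P.r p ∂μ ≤
        ∫ ω in P.cell (Cell.grid p), |(U : Ω →ₘ[μ] ℝ) ω * (H : Ω →ₘ[μ] ℝ) ω| ∂μ := by
      refine integral_mono_ae (integrable_const _) hint.integrableOn ?_
      refine (ae_restrict_iff' (P.measurableSet_cell _)).2 ?_
      filter_upwards [hae, P.coeFn_cellVar P.dualVal] with ω h1 h2 hω
      have hω' : P.idx ω = Cell.grid p := hω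
      rw [hω'] at h1 h2
      simp only [floor] at h1
      simp only [H]
      rw [h2]
      exact le_trans (mul_le_mul_of_nonneg_right h1 (P.r_pos p).le) (le_abs_self _)
    rw [setIntegral_const, smul_eq_mul] at hlow
    have hm := P.mul_measure_grid p
    have e : μ.real (P.cell (Cell.grid p)) * (((p.1 : ℝ) + 1)⁻¹ * a p * P.s p * P.r p) =
        ((p.1 : ℝ) + 1)⁻¹ * a p / 2 := by
      calc _ = ((p.1 : ℝ) + 1)⁻¹ * a p * (P.s p * P.r p * μ.real (P.cell (Cell.grid p))) := by ring
        _ = ((p.1 : ℝ) + 1)⁻¹ * a p * (1 / 2) := by rw [← hm]; rfl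
        _ = _ := by ring
    rw [e] at hlow
    have hp : (0 : ℝ) < (p.1 : ℝ) + 1 := by positivity
    rw [← inv_mul_le_iff₀ hp]
    linarith

section Limit

variable {a : ℕ → ℕ × ℕ → ℝ} {b u : ℕ × ℕ → ℝ} {K : ℝ}

/-- Fatou for series: the uniform bound passes to finite partial sums of the limit. -/
theorem IsCoeff.of_tendsto (ha : ∀ k, IsCoeff (a k))
    (hK : ∀ k, ∑' p : ℕ × ℕ, ((p.1 : ℝ) + 1) * a k p ≤ K)
    (hab : ∀ p, Tendsto (fun k => a k p) atTop (𝓝 (b p))) : IsCoeff b := by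
  have hb : ∀ p, 0 ≤ b p := fun p => ge_of_tendsto' (hab p) fun k => (ha k).nonneg p
  refine ⟨hb, summable_of_sum_le (c := K) (fun p => mul_nonneg (by positivity) (hb p)) fun F => ?_⟩
  refine le_of_tendsto' (tendsto_finsetSum F fun p _ => (hab p).const_mul _) fun k => ?_
  exact ((ha k).summable_mul.sum_le_tsum F fun p _ => (ha k).weighted_nonneg p).trans (hK k)

/-- No mass is lost in the limit: the coefficients with large first index are small because of the
weights, those with large second index because of the summable bound. -/
theorem le_tsum_of_tendsto (ha : ∀ k, IsCoeff (a k))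
    (hK : ∀ k, ∑' p : ℕ × ℕ, ((p.1 : ℝ) + 1) * a k p ≤ K)
    (hu : Summable u) (hu0 : ∀ p, 0 ≤ u p) (hau : ∀ k p, a k p ≤ ((p.1 : ℝ) + 1) * u p)
    (hab : ∀ p, Tendsto (fun k => a k p) atTop (𝓝 (b p))) {x : ℕ → ℝ} {x' : ℝ}
    (hx : Tendsto x atTop (𝓝 x')) (hle : ∀ k, x k ≤ ∑' p, a k p) : x' ≤ ∑' p, b p := by
  have hb := IsCoeff.of_tendsto ha hK hab
  -- Split at `p.1 = M`. The part `p.1 ≥ M` is at most `K / (M + 1)` by the weights; the part `p.1 <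
  -- M` is dominated by `M * u` and converges.
  have key : ∀ M : ℕ, x' ≤ ∑' p, b p + ((M : ℝ) + 1)⁻¹ * K := by
    intro M
    have hs : ∀ c : ℕ × ℕ → ℝ, IsCoeff c →
        Summable fun p : ℕ × ℕ => if p.1 < M then c p else 0 := fun c hc => by
      refine hc.summable.of_nonneg_of_le (fun p => ?_) fun p => ?_
      · split_ifs
        exacts [hc.nonneg p, le_rfl]
      · split_ifs
        exacts [le_rfl, hc.nonneg p]
    have h1 : ∀ k, ∑' p, a k p ≤
        ∑' p : ℕ × ℕ, (if p.1 < M then a k p else 0) + ((M : ℝ) + 1)⁻¹ * K := by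
      intro k
      calc ∑' p, a k p ≤ ∑' p : ℕ × ℕ, ((if p.1 < M then a k p else 0) +
            ((M : ℝ) + 1)⁻¹ * (((p.1 : ℝ) + 1) * a k p)) := by
            refine (ha k).summable.tsum_le_tsum (fun p => ?_)
              ((hs _ (ha k)).add ((ha k).summable_mul.mul_left _))
            have h0 := (ha k).nonneg p
            split_ifs with hp
            · have : 0 ≤ ((M : ℝ) + 1)⁻¹ * (((p.1 : ℝ) + 1) * a k p) := by positivity
              linarith
            · have hp' : (M : ℝ) ≤ p.1 := by exact_mod_cast not_lt.1 hp
              rw [zero_add, le_inv_mul_iff₀ (by positivity)]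
              exact mul_le_mul_of_nonneg_right (by linarith) h0
        _ = ∑' p : ℕ × ℕ, (if p.1 < M then a k p else 0) +
            ((M : ℝ) + 1)⁻¹ * ∑' p : ℕ × ℕ, ((p.1 : ℝ) + 1) * a k p := by
            rw [(hs _ (ha k)).tsum_add ((ha k).summable_mul.mul_left _), tsum_mul_left]
        _ ≤ _ := by
            gcongr
            exact hK k
    have hT : Tendsto (fun k => ∑' p : ℕ × ℕ, if p.1 < M then a k p else 0) atTop
        (𝓝 (∑' p : ℕ × ℕ, if p.1 < M then b p else 0)) := by
      refine tendsto_tsum_of_dominated_convergence (bound := fun p => (M : ℝ) * u p)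
        (hu.mul_left _) (fun p => ?_) (Eventually.of_forall fun k p => ?_)
      · split_ifs
        exacts [hab p, tendsto_const_nhds]
      · split_ifs with hp
        · have hp' : (p.1 : ℝ) + 1 ≤ M := by exact_mod_cast hp
          rw [Real.norm_eq_abs, abs_of_nonneg ((ha k).nonneg p)]
          exact (hau k p).trans (mul_le_mul_of_nonneg_right hp' (hu0 p))
        · rw [norm_zero]
          exact mul_nonneg M.cast_nonneg (hu0 p)
    have h2 := le_of_tendsto_of_tendsto' hx (hT.add_const (((M : ℝ) + 1)⁻¹ * K))
      fun k => (hle k).trans (h1 k)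
    refine h2.trans (add_le_add ((hs _ hb).tsum_le_tsum (fun p => ?_) hb.summable) le_rfl)
    split_ifs
    exacts [le_rfl, hb.nonneg p]
  have hlimM : Tendsto (fun M : ℕ => ∑' p, b p + ((M : ℝ) + 1)⁻¹ * K) atTop (𝓝 (∑' p, b p)) := by
    simpa [one_div] using
      ((tendsto_one_div_add_atTop_nhds_zero_nat (𝕜 := ℝ)).mul_const K).const_add (∑' p, b p)
  exact ge_of_tendsto' hlimM key

/-- Only `base`, where the sum enters with a minus sign, needs that no mass is lost. On `tail j` the
terms are nonnegative and finite partial sums suffice; on `grid p` a single coefficient is involved.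
-/
theorem floor_le_of_tendsto (P : CellPartition Φ μ) (ha : ∀ k, IsCoeff (a k))
    (hK : ∀ k, ∑' p : ℕ × ℕ, ((p.1 : ℝ) + 1) * a k p ≤ K)
    (hu : Summable u) (hu0 : ∀ p, 0 ≤ u p) (hau : ∀ k p, a k p ≤ ((p.1 : ℝ) + 1) * u p)
    (hab : ∀ p, Tendsto (fun k => a k p) atTop (𝓝 (b p))) {x : ℕ → ℝ} {x' : ℝ}
    (hx : Tendsto x atTop (𝓝 x')) {i : Cell} (hle : ∀ k, P.floor (a k) i ≤ x k) :
    P.floor b i ≤ x' := by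
  have hb := IsCoeff.of_tendsto ha hK hab
  cases i with
  | rest => exact ge_of_tendsto' hx hle
  | base =>
    simp only [floor] at hle ⊢
    have := le_tsum_of_tendsto ha hK hu hu0 hau hab hx.neg fun k => by linarith [hle k]
    linarith
  | tail j =>
    simp only [floor] at hle ⊢
    have ht := P.t_pos j
    rw [← le_div_iff₀ ht]
    refine Real.tsum_le_of_sum_le (fun p => ?_) fun F => ?_
    · split_ifs
      exacts [hb.weighted_nonneg p, le_rfl]
    · refine le_of_tendsto_of_tendsto' (tendsto_finsetSum F fun p _ => ?_) (hx.div_const (P.t j))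
        (f := fun k => ∑ p ∈ F, if p.2 ≤ j then ((p.1 : ℝ) + 1) * a k p else 0) fun k => ?_
      · split_ifs
        exacts [(hab p).const_mul _, tendsto_const_nhds]
      · rw [le_div_iff₀ ht]
        refine le_trans (mul_le_mul_of_nonneg_right ?_ ht.le) (hle k)
        refine ((ha k).summable_ite j).sum_le_tsum F fun p _ => ?_
        split_ifs
        exacts [(ha k).weighted_nonneg p, le_rfl]
  | grid p =>
    simp only [floor] at hle ⊢
    exact le_of_tendsto_of_tendsto' (((hab p).const_mul _).mul_const _) hx hle

end Limit

theorem isOrderClosed_cone [IsProbabilityMeasure μ] (P : CellPartition Φ μ)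
    (hΦ : IsOrliczFunction Φ) (hlim : IsSuperlinear Φ) : IsOrderClosed (P.cone hΦ) := by
  refine Subset.antisymm (fun X hX => ?_) ?_
  · have habs : AEEqFun.mk (fun ω => |(X : Ω →ₘ[μ] ℝ) ω|)
        (X : Ω →ₘ[μ] ℝ).aestronglyMeasurable.norm ∈ orliczSpace Φ hΦ μ := by
      refine mem_orliczSpace_of_abs_le hΦ X.2 ?_
      filter_upwards [AEEqFun.coeFn_mk (fun ω => |(X : Ω →ₘ[μ] ℝ) ω|)
        (X : Ω →ₘ[μ] ℝ).aestronglyMeasurable.norm] with ω hω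
      rw [hω, abs_abs]
    refine ⟨fun _ => X, fun _ => hX, Eventually.of_forall fun ω => tendsto_const_nhds,
      ⟨_, habs⟩, fun _ => ?_⟩
    filter_upwards [AEEqFun.coeFn_mk (fun ω => |(X : Ω →ₘ[μ] ℝ) ω|)
      (X : Ω →ₘ[μ] ℝ).aestronglyMeasurable.norm] with ω hω
    rw [hω]
  · rintro X' ⟨X, hX, hconv, U, hU⟩
    choose a ha hfloor using hX
    have haU : ∀ k, ∀ᵐ ω ∂μ, P.floor (a k) (P.idx ω) ≤ (U : Ω →ₘ[μ] ℝ) ω := fun k => by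
      filter_upwards [hfloor k, hU k] with ω h1 h2 using h1.trans ((le_abs_self _).trans h2)
    obtain ⟨K, hK⟩ := P.exists_tsum_le U
    obtain ⟨u, hu0, hu, hau⟩ := P.exists_summable_bound hlim U
    -- Each coefficient is at most the weighted sum, so all families lie in a compact metrizable
    -- product, from which a coordinatewise convergent subsequence is taken.
    have hbox : ∀ k, a k ∈ Set.pi univ fun _ : ℕ × ℕ => Icc (0 : ℝ) K := fun k p _ =>
      ⟨(ha k).nonneg p, ((ha k).le_mul p).trans
        (((ha k).summable_mul.le_tsum p fun q _ => (ha k).weighted_nonneg q).trans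
          (hK _ (ha k) (haU k)))⟩
    obtain ⟨b, -, φ, hφ, hb⟩ :=
      (isCompact_univ_pi fun _ : ℕ × ℕ => isCompact_Icc).tendsto_subseq hbox
    have hab : ∀ p, Tendsto (fun k => a (φ k) p) atTop (𝓝 (b p)) := fun p =>
      (tendsto_pi_nhds.1 hb) p
    refine ⟨b, IsCoeff.of_tendsto (fun k => ha (φ k)) (fun k => hK _ (ha _) (haU _)) hab, ?_⟩
    filter_upwards [hconv, ae_all_iff.2 hfloor] with ω h1 h2
    exact P.floor_le_of_tendsto (fun k => ha (φ k)) (fun k => hK _ (ha _) (haU _)) hu hu0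
      (fun k => hau _ (ha _) (haU _)) hab (h1.comp hφ.tendsto_atTop) fun k => h2 (φ k)

end CellPartition

end Orlicz

theorem lemma3p5 {Ω : Type*} [MeasurableSpace Ω] (μ : Measure Ω) [IsProbabilityMeasure μ]
    (hμ : Orlicz.IsNonatomic μ)
    (Φ : ℝ → ℝ) (hΦ : Orlicz.IsOrliczFunction Φ) (hlim : Orlicz.IsSuperlinear Φ)
    (hpos : ∀ t : ℝ, 0 < t → 0 < Φ t)
    (hΦ₂ : ¬ Orlicz.DeltaTwo Φ) (hΨ₂ : ¬ Orlicz.DeltaTwo (Orlicz.conjugate Φ)) :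
    ∃ C : Set (Orlicz.orliczSpace Φ hΦ μ),
      Orlicz.IsMonotone C ∧ Orlicz.IsPositivelyHomogeneous C ∧ Orlicz.IsAdditive C ∧
      Orlicz.IsOrderClosed C ∧
      ¬ IsClosed[Orlicz.weakTopology (Orlicz.orliczSpace Φ hΦ μ)
          (Orlicz.orliczSpace (Orlicz.conjugate Φ) (hΦ.conjugate hlim) μ)] C ∧
      ∀ X : Orlicz.orliczSpace Φ hΦ μ, ∃ k : ℝ, X - k • Orlicz.one Φ hΦ μ ∉ C := by
  obtain ⟨P⟩ := hμ.nonempty_cellPartition hΦ hlim hΦ₂ hΨ₂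
  exact ⟨P.cone hΦ, P.isMonotone_cone hΦ, P.isPositivelyHomogeneous_cone hΦ, P.isAdditive_cone hΦ,
    P.isOrderClosed_cone hΦ hlim, P.not_isClosed_cone hΦ hlim,
    P.exists_sub_smul_one_notMem_cone hΦ⟩
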